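/- Let $Q$ be a finite bipartite quiver with source vertices $v_1,\dots,v_k$ and sink vertices $w_1,\dots,w_m$; let $\mathcal A_{ij}$ be the finite set of arrows from $v_i$ to $w_j$, and let $Q_0=\{v_1,\dots,v_k,w_1,\dots,w_m\}$. Let $\beta\in\mathbb Z_{>0}^{Q_0}$ be a dimension vector and $\sigma\in\mathbb Z^{Q_0}$ a weight with $\sigma_+(v_i):=\sigma(v_i)>0$ for all $i$, $\sigma_-(w_j):=-\sigma(w_j)>0$ for all $j$, and $\sum_{x\in Q_0}\sigma(x)\beta(x)=0$. Put $N=\sum_i\sigma_+(v_i)\beta(v_i)=\sum_j\sigma_-(w_j)\beta(w_j)$. Let $0\neq V\in\operatorname{rep}(Q,\beta)$, that is, $V=(V(a))_a$ is a family of matrices $V(a)\in\mathbb R^{\beta(w_j)\times\beta(v_i)}$ ($a\in\mathcal A_{ij}$), not all zero. *Stability.* A subrepresentation $V'$ of $V$ is a family of subspaces $V'(x)\subseteq\mathbb R^{\beta(x)}$, $x\in Q_0$, with $V(a)V'(v_i)\subseteq V'(w_j)$ for all $a\in\mathcal A_{ij}$; write $\sigma\cdot\dim V'=\sum_x\sigma(x)\dim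 V'(x)$. A nonzero representation $W$ is $\sigma$-stable if $\sigma\cdot\dim W=0$ and $\sigma\cdot\dim W'<0$ for all subrepresentations $W'\ne 0,W$ of $W$; and $V$ is $\sigma$-polystable if it is a finite direct sum of $\sigma$-stable representations. *Capacity.* Consider $N\times N$ matrices whose rows are divided into $\sigma_-(w_j)$ blocks of size $\beta(w_j)$ for each $j$, and whose columns are divided into $\sigma_+(v_i)$ blocks of size $\beta(v_i)$ for each $i$. For $a\in\mathcal A_{ij}$, a row block $q$ belonging to $w_j$ and a column block $r$ belonging to $v_i$, let $V^{ij,a}_{q,r}$ be the matrix whose $(q,r)$ block is $V(a)$ and whose other entries are zero. Put $$T_{V,\sigma}(X)=\sum_{i,j,a,q,r}(V^{ij,a}_{q,r})^T X\,V^{ij,a}_{q,r},\qquad \mathbf{cap}(V,\sigma)=\inf\{\det T_{V,\sigma}(X)\mid X\in\mathbb R^{N\times N}\text{ positive definite},\ \det X=1\}.$$ For a tuple $\Sigma=(\Sigma_i)_{i=1}^k$ of positive definite matrices $\Sigma_i\in\mathbb R^{\beta(v_i)\times\beta(v_i)}$ put $$\mathbf{cap}(V,\sigma;\Sigma)=\frac{\prod_{j=1}^m\det\Big(\sum_{i=1}^k\sigma_+(v_i)\sum_{a\in\mathcal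 A_{ij}}V(a)\Sigma_iV(a)^T\Big)^{\sigma_-(w_j)}}{\prod_{i=1}^k\det(\Sigma_i)^{\sigma_+(v_i)}}.$$ Call $\Sigma$ a gaussian extremizer for $(V,\sigma)$ if $\mathbf{cap}(V,\sigma)=\mathbf{cap}(V,\sigma;\Sigma)$, and call $(V,\sigma)$ gaussian-extremizable if it has a gaussian extremizer. *Geometric data.* $(V,\sigma)$ is geometric if $\sum_j\sigma_-(w_j)\sum_{a\in\mathcal A_{ij}}V(a)^TV(a)=\mathbf I$ for all $i$ and $\sum_i\sigma_+(v_i)\sum_{a\in\mathcal A_{ij}}V(a)V(a)^T=\mathbf I$ for all $j$. For $g=(g(x))_x\in\operatorname{GL}(\beta)=\prod_{x}\operatorname{GL}(\beta(x),\mathbb R)$ let $(g\cdot V)(a)=g(w_j)V(a)g(v_i)^{-1}$ for $a\in\mathcal A_{ij}$, and let $\mathcal G_\sigma(V)=\{g\in\operatorname{GL}(\beta)\mid (g\cdot V,\sigma)\text{ is geometric}\}$. **Theorem.** The following statements are equivalent: 1. $V$ is $\sigma$-polystable; 2. $(V,\sigma)$ is gaussian-extremizable, and for every sink $w_j$ the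 images of the maps $V(a)$, over all arrows $a$ with head $w_j$, together span $\mathbb R^{\beta(w_j)}$. In particular, if this spanning condition holds, then $V$ is $\sigma$-polystable if and only if $(V,\sigma)$ is gaussian-extremizable. If the equivalent statements hold, then the gaussian extremizers for $(V,\sigma)$ are exactly the tuples $\big(g(v_i)^{-1}g(v_i)^{-T}\big)_{i=1}^k$ with $g\in\mathcal G_\sigma(V)$. -/

import Mathlib

/-! A finite bipartite quiver with source vertices `I`, sink vertices `J` and vertex set `I ⊕ J`
is given by the finite types `A i j` of arrows from `i` to `j`. -/

namespace BipartiteQuiver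

noncomputable section

variable {I J : Type*} {A : I → J → Type*} {β : I ⊕ J → ℕ}

/-- The representation space `rep(Q, β)`: a real `β(j) × β(i)` matrix for every arrow `i → j`. -/
abbrev Rep (A : I → J → Type*) (β : I ⊕ J → ℕ) :=
  ∀ i j, A i j → Matrix (Fin (β (Sum.inr j))) (Fin (β (Sum.inl i))) ℝ

/-- The base change group `GL(β)`. -/
abbrev GLβ (β : I ⊕ J → ℕ) := ∀ x, GL (Fin (β x)) ℝ

/-- The base change action `(g · V)(a) = g(ha) V(a) g(ta)⁻¹`. -/
def act (g : GLβ β) (V : Rep A β) : Rep A β := fun i j a =>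
  (g (Sum.inr j)).val * V i j a * ((g (Sum.inl i))⁻¹).val

/-- A subrepresentation of `V`. -/
@[ext]
structure SubRep (V : Rep A β) where
  /-- The subspace at each vertex. -/
  space : ∀ x, Submodule ℝ (Fin (β x) → ℝ)
  map_mem : ∀ i j (a : A i j), ∀ u ∈ space (Sum.inl i), (V i j a).mulVec u ∈ space (Sum.inr j)

/-- `σ · dim W`. -/
def weight [Fintype I] [Fintype J] {V : Rep A β} (σ : I ⊕ J → ℤ) (W : SubRep V) : ℤ :=
  ∑ x, σ x * (Module.finrank ℝ (W.space x) : ℤ)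

/-- The subrepresentation `W` of `V`, viewed as a representation, is `σ`-stable: it is nonzero,
`σ · dim W = 0`, and `σ · dim W' < 0` for every subrepresentation `W'` of `W` (that is, every
subrepresentation of `V` contained in `W`) different from `0` and `W`. -/
def IsStable [Fintype I] [Fintype J] {V : Rep A β} (σ : I ⊕ J → ℤ) (W : SubRep V) : Prop :=
  (∃ x, W.space x ≠ ⊥) ∧ weight σ W = 0 ∧
    ∀ W' : SubRep V, (∀ x, W'.space x ≤ W.space x) → (∃ x, W'.space x ≠ ⊥) → W' ≠ W →
      weight σ W' < 0

/-- `V` is `σ`-polystable: it is a finite (internal) direct sum of `σ`-stable representations. -/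
def IsPolystable [Fintype I] [Fintype J] (V : Rep A β) (σ : I ⊕ J → ℤ) : Prop :=
  ∃ (n : ℕ) (W : Fin n → SubRep V), (∀ l, IsStable σ (W l)) ∧
    ∀ x, DirectSum.IsInternal (fun l => (W l).space x)

/-- `σ₊(i) = σ(i)` at a source vertex, where `σ` is positive. -/
def sigmaPlus (σ : I ⊕ J → ℤ) (i : I) : ℕ := (σ (Sum.inl i)).toNat

/-- `σ₋(j) = -σ(j)` at a sink vertex, where `σ` is negative. -/
def sigmaMinus (σ : I ⊕ J → ℤ) (j : J) : ℕ := (-σ (Sum.inr j)).toNat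

/-- Row indices of the block matrices: `σ₋(j)` blocks of size `β(j)` for each sink `j`. -/
abbrev RowIdx (β : I ⊕ J → ℕ) (σ : I ⊕ J → ℤ) :=
  Σ j : J, Fin (sigmaMinus σ j) × Fin (β (Sum.inr j))

/-- Column indices of the block matrices: `σ₊(i)` blocks of size `β(i)` for each source `i`.
If `σ · β = 0` there are as many rows as columns. -/
abbrev ColIdx (β : I ⊕ J → ℕ) (σ : I ⊕ J → ℤ) :=
  Σ i : I, Fin (sigmaPlus σ i) × Fin (β (Sum.inl i))

/-- The Kraus operator whose `(q, r)` block is `V(a)` and whose other blocks are zero. -/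
def kraus [DecidableEq I] [DecidableEq J] (V : Rep A β) (σ : I ⊕ J → ℤ) (i : I) (j : J)
    (a : A i j) (q : Fin (sigmaMinus σ j)) (r : Fin (sigmaPlus σ i)) :
    Matrix (RowIdx β σ) (ColIdx β σ) ℝ :=
  ∑ s, ∑ u, Matrix.single ⟨j, q, s⟩ ⟨i, r, u⟩ (V i j a s u)

section Capacity

variable [Fintype I] [Fintype J] [DecidableEq I] [DecidableEq J] [∀ i j, Fintype (A i j)]

/-- The Brascamp-Lieb operator `T_{V,σ}(X) = ∑ Kᵀ X K`, `K` running over the Kraus operators. -/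
def blOperator (V : Rep A β) (σ : I ⊕ J → ℤ) (X : Matrix (RowIdx β σ) (RowIdx β σ) ℝ) :
    Matrix (ColIdx β σ) (ColIdx β σ) ℝ :=
  ∑ i, ∑ j, ∑ a : A i j, ∑ q, ∑ r,
    (kraus V σ i j a q r).transpose * X * kraus V σ i j a q r

/-- The capacity `cap(V, σ)`. -/
def cap (V : Rep A β) (σ : I ⊕ J → ℤ) : ℝ :=
  sInf {c | ∃ X : Matrix (RowIdx β σ) (RowIdx β σ) ℝ,
    X.PosDef ∧ X.det = 1 ∧ c = (blOperator V σ X).det}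

end Capacity

section Extremizers

variable [Fintype I] [Fintype J] [∀ i j, Fintype (A i j)]

/-- The quotient `cap(V, σ; S)` for a tuple `S` of matrices at the source vertices. -/
def capAt (V : Rep A β) (σ : I ⊕ J → ℤ)
    (S : ∀ i : I, Matrix (Fin (β (Sum.inl i))) (Fin (β (Sum.inl i))) ℝ) : ℝ :=
  (∏ j, (∑ i, (sigmaPlus σ i : ℝ) •
      ∑ a : A i j, V i j a * S i * (V i j a).transpose).det ^ sigmaMinus σ j) /
    ∏ i, (S i).det ^ sigmaPlus σ i

/-- `S` is a gaussian extremizer for `(V, σ)`. -/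
def IsGaussianExtremizer [DecidableEq I] [DecidableEq J] (V : Rep A β) (σ : I ⊕ J → ℤ)
    (S : ∀ i : I, Matrix (Fin (β (Sum.inl i))) (Fin (β (Sum.inl i))) ℝ) : Prop :=
  (∀ i, (S i).PosDef) ∧ cap V σ = capAt V σ S

/-- `(V, σ)` is gaussian-extremizable. -/
def IsGaussianExtremizable [DecidableEq I] [DecidableEq J] (V : Rep A β) (σ : I ⊕ J → ℤ) : Prop :=
  ∃ S, IsGaussianExtremizer V σ S

/-- `(V, σ)` is a geometric quiver datum. -/
def IsGeometric (V : Rep A β) (σ : I ⊕ J → ℤ) : Prop :=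
  (∀ i, ∑ j, (sigmaMinus σ j : ℝ) • ∑ a : A i j, (V i j a).transpose * V i j a = 1) ∧
    ∀ j, ∑ i, (sigmaPlus σ i : ℝ) • ∑ a : A i j, V i j a * (V i j a).transpose = 1

/-- The set `𝒢_σ(V)` of base changes that make `(V, σ)` geometric. -/
def geometrizers (V : Rep A β) (σ : I ⊕ J → ℤ) : Set (GLβ β) :=
  {g | IsGeometric (act g V) σ}

end Extremizers

/-- At every sink the images of the incoming arrows together span, i.e. the map
`⨁ V(ta) → V(j)` over all arrows `a` with head `j` is surjective. -/
def SpansSinks (V : Rep A β) : Prop :=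
  ∀ j, ⨆ i, ⨆ a : A i j, LinearMap.range (V i j a).mulVecLin = ⊤

end

end BipartiteQuiver

open Matrix
open scoped Kronecker

set_option linter.unusedSectionVars false

/-! Everything passes through balanced tuples. For `S` at the sources let `Q` be its push-forward to
the sinks, `pushForm V σ S`. Call `S` balanced if `Q` is positive definite and the pull-back of
`Q⁻¹` is `S⁻¹`. Factoring `S = L Lᵀ` and `Q = R Rᵀ`, the base change by `L⁻¹` and `R⁻¹` turns these
equations into the two identities of a geometric datum (`BipartiteQuiver.isBalanced_iff`). So it
remains to compare balanced tuples with extremizers and with polystability.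

Extremizers. In block form, `capAt V σ S` is `det Q / det S`. For any `S` with `Q` positive
definite, the trace of `T(Q⁻¹) S` is `N`, so by AM-GM its determinant is at most 1, with equality
only if `T(Q⁻¹) S = 1`, that is, if `S` is balanced. Testing the capacity at `X = Q⁻¹` shows that an
extremizer has determinant at least 1, hence is balanced; the spanning condition is what makes `Q`
invertible. Conversely a balanced `S` scales `T` to a doubly stochastic map. Such maps do not
decrease determinants (`det_le_det_sum_of_doublyStochastic`), and this gives the lower bound for the
capacity.

Balanced implies polystable. For a geometric datum the weight of a subrepresentation is minus a sum
of squared norms (`IsGeometric.weight_eq`). Hence weights are nonpositive, and if a weight vanishes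
then the orthogonal complements form a subrepresentation as well. Splitting off minimal
subrepresentations of weight zero gives the decomposition.

Polystable implies balanced. Balanced tuples add up along direct sums, so one may assume `V` stable.
Adjoin `ε` times every matrix unit as a new arrow: then `det S / det Q` attains its maximum on a
compact set, and a maximizer is balanced. As `ε → 0`, compactness yields a geometric `U` and a
nonzero morphism `h` from `V`, with zero new arrows, to `U`. The image of `h` has weight at most 0,
so its kernel has weight at least 0; stability forces the kernel to vanish. Thus `h` is the required
base change. -/

/-! ### Real positive definite matrices. -/

/-- Orthogonal diagonalization of a real positive definite matrix. -/
theorem Matrix.PosDef.exists_transpose_mul_mul_eq_diagonal {n : Type*} [Fintype n] [DecidableEq n]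
    {S : Matrix n n ℝ} (hS : S.PosDef) : ∃ (U : Matrix n n ℝ) (d : n → ℝ),
      Uᵀ * U = 1 ∧ U * Uᵀ = 1 ∧ (∀ i, 0 < d i) ∧ S = U * diagonal d * Uᵀ ∧ S.det = ∏ i, d i := by
  refine ⟨hS.1.eigenvectorUnitary, hS.1.eigenvalues, ?_, ?_, hS.eigenvalues_pos, ?_, ?_⟩
  · simpa [star_eq_conjTranspose] using Unitary.coe_star_mul_self hS.1.eigenvectorUnitary
  · simpa [star_eq_conjTranspose] using Unitary.coe_mul_star_self hS.1.eigenvectorUnitary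
  · have := hS.1.spectral_theorem
    rw [Unitary.conjStarAlgAut_apply] at this
    simpa [star_eq_conjTranspose] using this
  · simpa using hS.1.det_eq_prod_eigenvalues

/-- A real positive definite matrix factors as `L Lᵀ` with `L` invertible. -/
theorem Matrix.PosDef.exists_eq_mul_transpose {n : Type*} [Fintype n] [DecidableEq n]
    {S : Matrix n n ℝ} (hS : S.PosDef) : ∃ L : GL n ℝ, S = L.val * L.valᵀ := by
  obtain ⟨U, d, -, -, hd, hs, -⟩ := hS.exists_transpose_mul_mul_eq_diagonal
  set D : Matrix n n ℝ := diagonal fun i => √(d i) with hD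
  have hDD : D * Dᵀ = diagonal d := by
    simp [hD, diagonal_mul_diagonal, Real.mul_self_sqrt (hd _).le]
  have hUD : IsUnit (U * D) := by
    rw [isUnit_iff_isUnit_det, isUnit_iff_ne_zero]
    have h := hS.det_pos
    rw [hs, ← hDD] at h
    intro h0
    rw [det_mul] at h0
    simp only [det_mul, det_transpose] at h
    nlinarith
  refine ⟨hUD.unit, ?_⟩
  rw [IsUnit.unit_spec, hs, ← hDD, transpose_mul]
  simp only [Matrix.mul_assoc]

theorem Matrix.PosSemidef.transpose_mul_mul_same {m n : Type*} [Fintype m] [Fintype n]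
    {S : Matrix n n ℝ} (hS : S.PosSemidef) (B : Matrix n m ℝ) : (Bᵀ * S * B).PosSemidef := by
  simpa using hS.conjTranspose_mul_mul_same B

theorem Matrix.PosSemidef.mul_mul_transpose_same {m n : Type*} [Fintype m] [Fintype n]
    {S : Matrix n n ℝ} (hS : S.PosSemidef) (B : Matrix m n ℝ) : (B * S * Bᵀ).PosSemidef := by
  simpa using hS.mul_mul_conjTranspose_same B

theorem Matrix.PosSemidef.posDef_of_det_ne_zero {n : Type*} [Fintype n] [DecidableEq n]
    {S : Matrix n n ℝ} (hS : S.PosSemidef) (h : S.det ≠ 0) : S.PosDef := by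
  refine hS.1.posDef_iff_eigenvalues_pos.2 fun i => (hS.eigenvalues_nonneg i).lt_of_ne' fun h0 => h ?_
  rw [hS.1.det_eq_prod_eigenvalues]
  exact Finset.prod_eq_zero (Finset.mem_univ i) (by simpa using h0)

/-- `L Lᵀ` is positive definite for invertible `L`. -/
theorem Matrix.posDef_mul_transpose {n : Type*} [Fintype n] [DecidableEq n] (L : GL n ℝ) :
    (L.val * L.valᵀ).PosDef := by
  refine Matrix.PosSemidef.posDef_of_det_ne_zero ?_ ?_
  · simpa using posSemidef_self_mul_conjTranspose L.val
  · rw [det_mul, det_transpose]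
    have : L.val.det ≠ 0 := by
      simpa [isUnit_iff_ne_zero] using (isUnit_iff_isUnit_det _).1 L.isUnit
    exact mul_ne_zero this this

theorem Matrix.inv_mul_transpose_eq {n : Type*} [Fintype n] [DecidableEq n] (L : GL n ℝ) :
    (L.val * L.valᵀ)⁻¹ = (L⁻¹).valᵀ * (L⁻¹).val := by
  apply inv_eq_left_inv
  have h : (L⁻¹).val * L.val = 1 := by simp
  rw [Matrix.mul_assoc, ← Matrix.mul_assoc (L⁻¹).val, h, Matrix.one_mul, ← transpose_mul]
  simp

/-! ### AM-GM for trace and determinant, with its equality case. -/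

section Trace

variable {n : Type*} [Fintype n] [DecidableEq n]

/-- Multiply `t ≤ exp (t - 1)` over the eigenvalues, which are nonnegative. -/
theorem Matrix.PosSemidef.det_le_exp_trace_sub {Z : Matrix n n ℝ} (hZ : Z.PosSemidef) :
    Z.det ≤ Real.exp (Z.trace - Fintype.card n) := by
  rw [hZ.1.det_eq_prod_eigenvalues, hZ.1.trace_eq_sum_eigenvalues]
  have : (∑ i, ((hZ.1.eigenvalues i : ℝ) : ℝ)) - Fintype.card n
      = ∑ i, (hZ.1.eigenvalues i - 1) := by simp [Finset.sum_sub_distrib]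
  simp only [RCLike.ofReal_real_eq_id, id]
  rw [this, Real.exp_sum]
  refine Finset.prod_le_prod (fun i _ => hZ.eigenvalues_nonneg i) fun i _ => ?_
  linarith [Real.add_one_le_exp (hZ.1.eigenvalues i - 1)]

/-- The inequality `t ≤ exp (t - 1)` is strict unless `t = 1`, so an eigenvalue other than 1 would
push the determinant below `exp 0 = 1`. -/
theorem Matrix.PosSemidef.eq_one_of_trace_eq {Z : Matrix n n ℝ} (hZ : Z.PosSemidef)
    (htr : Z.trace = Fintype.card n) (hdet : 1 ≤ Z.det) : Z = 1 := by
  have hpos : ∀ i, 0 < hZ.1.eigenvalues i :=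
    hZ.1.posDef_iff_eigenvalues_pos.1 (hZ.posDef_of_det_ne_zero (by linarith))
  have key : ∀ i, hZ.1.eigenvalues i = 1 := by
    by_contra! h
    obtain ⟨i, hi⟩ := h
    have h1 : ∏ i, hZ.1.eigenvalues i < ∏ i, Real.exp (hZ.1.eigenvalues i - 1) := by
      refine Finset.prod_lt_prod (fun i _ => hpos i) (fun i _ => ?_) ⟨i, Finset.mem_univ i, ?_⟩
      · linarith [Real.add_one_le_exp (hZ.1.eigenvalues i - 1)]
      · linarith [Real.add_one_lt_exp (sub_ne_zero.2 hi)]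
    rw [← Real.exp_sum] at h1
    have h2 : ∑ i, (hZ.1.eigenvalues i - 1) = 0 := by
      have := hZ.1.trace_eq_sum_eigenvalues
      rw [htr] at this
      simp only [RCLike.ofReal_real_eq_id, id] at this
      simp [Finset.sum_sub_distrib, ← this]
    have h3 := hZ.1.det_eq_prod_eigenvalues
    simp only [RCLike.ofReal_real_eq_id, id] at h3
    rw [h2, Real.exp_zero, ← h3] at h1
    linarith
  have hs := hZ.1.spectral_theorem
  rw [Unitary.conjStarAlgAut_apply] at hs
  rw [hs]
  have : (RCLike.ofReal ∘ hZ.1.eigenvalues : n → ℝ) = 1 := by ext i; simp [key i]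
  rw [this]
  simp

/-- With `S = L Lᵀ`, the product `T S`, not symmetric in general, has the trace and determinant of
the positive semidefinite `Lᵀ T L`. -/
theorem Matrix.PosSemidef.det_mul_le_exp {T S : Matrix n n ℝ} (hT : T.PosSemidef)
    (hS : S.PosDef) : (T * S).det ≤ Real.exp ((T * S).trace - Fintype.card n) := by
  obtain ⟨L, rfl⟩ := hS.exists_eq_mul_transpose
  have h := (hT.transpose_mul_mul_same L.val).det_le_exp_trace_sub
  have h1 : (T * (L.val * L.valᵀ)).trace = (L.valᵀ * T * L.val).trace := by
    rw [← Matrix.mul_assoc, trace_mul_comm, Matrix.mul_assoc]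
  have h2 : (T * (L.val * L.valᵀ)).det = (L.valᵀ * T * L.val).det := by
    simp only [det_mul]; ring
  rw [h1, h2]; exact h

theorem Matrix.PosSemidef.mul_eq_one_of_trace_eq {T S : Matrix n n ℝ} (hT : T.PosSemidef)
    (hS : S.PosDef) (htr : (T * S).trace = Fintype.card n) (hdet : 1 ≤ (T * S).det) :
    T * S = 1 := by
  obtain ⟨L, rfl⟩ := hS.exists_eq_mul_transpose
  have h1 : (T * (L.val * L.valᵀ)).trace = (L.valᵀ * T * L.val).trace := by
    rw [← Matrix.mul_assoc, trace_mul_comm, Matrix.mul_assoc]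
  have h2 : (T * (L.val * L.valᵀ)).det = (L.valᵀ * T * L.val).det := by
    simp only [det_mul]; ring
  have h := (hT.transpose_mul_mul_same L.val).eq_one_of_trace_eq (h1 ▸ htr) (h2 ▸ hdet)
  rw [Matrix.mul_assoc, mul_eq_one_comm] at h
  rwa [← Matrix.mul_assoc]

end Trace

/-! ### Determinant bounds for completely positive maps. -/

section Kraus

variable {ι m n : Type*} [Fintype ι] [Fintype m] [Fintype n] [DecidableEq m] [DecidableEq n]

/-- A doubly stochastic completely positive map does not decrease determinants. -/
theorem det_le_det_sum_of_doublyStochastic (K : ι → Matrix m n ℝ)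
    (h₁ : ∑ l, (K l)ᵀ * K l = 1) (h₂ : ∑ l, K l * (K l)ᵀ = 1) {X : Matrix m m ℝ}
    (hX : X.PosDef) : X.det ≤ (∑ l, (K l)ᵀ * X * K l).det := by
  have hT : (∑ l, (K l)ᵀ * X * K l).PosDef := by
    refine PosDef.of_dotProduct_mulVec_pos ?_ fun u hu => ?_
    · exact (posSemidef_sum _ fun l _ => hX.posSemidef.transpose_mul_mul_same (K l)).1
    · have h3 : ∀ l, star u ⬝ᵥ (((K l)ᵀ * X * K l) *ᵥ u) = star (K l *ᵥ u) ⬝ᵥ (X *ᵥ (K l *ᵥ u)) := by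
        intro l
        simp only [star_trivial, ← mulVec_mulVec]
        rw [dotProduct_mulVec, vecMul_transpose]
      rw [sum_mulVec, dotProduct_sum]
      simp only [h3]
      obtain ⟨l, hl⟩ : ∃ l, K l *ᵥ u ≠ 0 := by
        by_contra! h
        apply hu
        have : (∑ l, (K l)ᵀ * K l) *ᵥ u = 0 := by
          rw [sum_mulVec]
          exact Finset.sum_eq_zero fun l _ => by rw [← mulVec_mulVec, h l, mulVec_zero]
        rwa [h₁, one_mulVec] at this
      exact Finset.sum_pos' (fun l _ => hX.posSemidef.dotProduct_mulVec_nonneg _)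
        ⟨l, Finset.mem_univ l, hX.dotProduct_mulVec_pos hl⟩
  obtain ⟨O, a, hO, hO', ha, hXe, hXd⟩ := hX.exists_transpose_mul_mul_eq_diagonal
  obtain ⟨P, b, hP, hP', hb, hTe, hTd⟩ := hT.exists_transpose_mul_mul_eq_diagonal
  -- In eigenbases of `X` and of its image, the squared entries of the Kraus operators form a doubly
  -- stochastic array, and the eigenvalues `b` of the image are averages of the eigenvalues `a` of
  -- `X`.
  set D : m → n → ℝ := fun t s => ∑ l, (Oᵀ * K l * P) t s ^ 2 with hD
  have hDnn : ∀ t s, 0 ≤ D t s := fun t s => Finset.sum_nonneg fun l _ => sq_nonneg _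
  have hcol : ∀ s, ∑ t, D t s = 1 := by
    intro s
    have h : Pᵀ * (∑ l, (K l)ᵀ * K l) * P = ∑ l, (Oᵀ * K l * P)ᵀ * (Oᵀ * K l * P) := by
      rw [Matrix.mul_sum, Matrix.sum_mul]
      refine Finset.sum_congr rfl fun l _ => ?_
      simp only [transpose_mul, transpose_transpose]
      calc _ = Pᵀ * ((K l)ᵀ * (1 : Matrix m m ℝ) * K l) * P := by simp
        _ = _ := by rw [← hO']; simp only [Matrix.mul_assoc]
    rw [h₁, Matrix.mul_one, hP] at h
    have h' := congrFun (congrFun h s) s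
    rw [one_apply_eq, Matrix.sum_apply] at h'
    rw [h', Finset.sum_comm]
    refine Finset.sum_congr rfl fun l _ => ?_
    rw [Matrix.mul_apply]; simp only [transpose_apply, sq]
  have hrow : ∀ t, ∑ s, D t s = 1 := by
    intro t
    have h : Oᵀ * (∑ l, K l * (K l)ᵀ) * O = ∑ l, (Oᵀ * K l * P) * (Oᵀ * K l * P)ᵀ := by
      rw [Matrix.mul_sum, Matrix.sum_mul]
      refine Finset.sum_congr rfl fun l _ => ?_
      simp only [transpose_mul, transpose_transpose]
      calc _ = Oᵀ * (K l * (1 : Matrix n n ℝ) * (K l)ᵀ) * O := by simp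
        _ = _ := by rw [← hP']; simp only [Matrix.mul_assoc]
    rw [h₂, Matrix.mul_one, hO] at h
    have h' := congrFun (congrFun h t) t
    rw [one_apply_eq, Matrix.sum_apply] at h'
    rw [h', Finset.sum_comm]
    refine Finset.sum_congr rfl fun l _ => ?_
    rw [Matrix.mul_apply]; simp only [transpose_apply, sq]
  have hbs : ∀ s, b s = ∑ t, D t s * a t := by
    intro s
    have h : diagonal b = ∑ l, (Oᵀ * K l * P)ᵀ * diagonal a * (Oᵀ * K l * P) := by
      have e : diagonal b = Pᵀ * (∑ l, (K l)ᵀ * X * K l) * P := by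
        rw [hTe]
        calc _ = (Pᵀ * P) * diagonal b * (Pᵀ * P) := by simp [hP]
          _ = _ := by simp only [Matrix.mul_assoc]
      rw [e, hXe, Matrix.mul_sum, Matrix.sum_mul]
      refine Finset.sum_congr rfl fun l _ => ?_
      simp only [transpose_mul, transpose_transpose, Matrix.mul_assoc]
    have h' := congrFun (congrFun h s) s
    rw [diagonal_apply_eq, Matrix.sum_apply] at h'
    rw [h']
    simp only [hD, Finset.sum_mul]
    rw [Finset.sum_comm]
    refine Finset.sum_congr rfl fun l _ => ?_
    rw [Matrix.mul_apply]
    refine Finset.sum_congr rfl fun t _ => ?_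
    rw [mul_diagonal, transpose_apply]; ring
  -- Jensen for the logarithm uses the column sums; the row sums then make the total of the averaged
  -- logarithms equal to `log (det X)`.
  have hlog : ∀ s, ∑ t, D t s * Real.log (a t) ≤ Real.log (b s) := by
    intro s
    have := strictConcaveOn_log_Ioi.concaveOn.le_map_sum (t := Finset.univ)
      (w := fun t => D t s) (p := a) (fun t _ => hDnn t s) (hcol s) (fun t _ => ha t)
    simpa [hbs s, smul_eq_mul] using this
  have hfin : Real.log X.det ≤ Real.log (∑ l, (K l)ᵀ * X * K l).det := by
    rw [hXd, hTd, Real.log_prod fun t _ => (ha t).ne', Real.log_prod fun s _ => (hb s).ne']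
    calc ∑ t, Real.log (a t) = ∑ t, (∑ s, D t s) * Real.log (a t) := by simp [hrow]
      _ = ∑ s, ∑ t, D t s * Real.log (a t) := by
        simp only [Finset.sum_mul]; rw [Finset.sum_comm]
      _ ≤ _ := Finset.sum_le_sum fun s _ => hlog s
  exact (Real.log_le_log_iff hX.det_pos hT.det_pos).1 hfin

/-- Determinant bound for a completely positive map that `S` and `Q` scale to a doubly
stochastic one. -/
theorem det_mul_det_le_of_scaling (K : ι → Matrix m n ℝ) {S : Matrix n n ℝ} {Q : Matrix m m ℝ}
    (hS : S.PosDef) (hQ : Q.PosDef) (h₁ : ∑ l, K l * S * (K l)ᵀ = Q)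
    (h₂ : ∑ l, (K l)ᵀ * Q⁻¹ * K l = S⁻¹) {X : Matrix m m ℝ} (hX : X.PosDef) :
    X.det * Q.det ≤ (∑ l, (K l)ᵀ * X * K l).det * S.det := by
  obtain ⟨L, rfl⟩ := hS.exists_eq_mul_transpose
  obtain ⟨R, rfl⟩ := hQ.exists_eq_mul_transpose
  have hLi : (L⁻¹).val * L.val = 1 := by simp
  have hLi' : L.valᵀ * (L⁻¹).valᵀ = 1 := by rw [← transpose_mul, hLi, transpose_one]
  have hRi : (R⁻¹).val * R.val = 1 := by simp
  have hRi' : R.valᵀ * (R⁻¹).valᵀ = 1 := by rw [← transpose_mul, hRi, transpose_one]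
  have hRinv := inv_mul_transpose_eq R
  have hLinv := inv_mul_transpose_eq L
  -- With `S = L Lᵀ` and `Q = R Rᵀ`, the operators `R⁻¹ K L` are doubly stochastic; taking `Rᵀ X R`
  -- as argument undoes the scaling by `R`.
  have key := det_le_det_sum_of_doublyStochastic (fun l => (R⁻¹).val * K l * L.val)
    (X := R.valᵀ * X * R.val) ?_ ?_ ?_
  · have e : ∑ l, ((R⁻¹).val * K l * L.val)ᵀ * (R.valᵀ * X * R.val) * ((R⁻¹).val * K l * L.val)
        = L.valᵀ * (∑ l, (K l)ᵀ * X * K l) * L.val := by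
      rw [Matrix.mul_sum, Matrix.sum_mul]
      refine Finset.sum_congr rfl fun l _ => ?_
      have r1 : R.val * (R⁻¹).val = 1 := by simp
      have r2 : (R⁻¹).valᵀ * R.valᵀ = 1 := by rw [← transpose_mul, r1, transpose_one]
      calc _ = L.valᵀ * ((K l)ᵀ * ((R⁻¹).valᵀ * R.valᵀ) * X * (R.val * (R⁻¹).val) * K l) * L.val := by
            simp only [transpose_mul, Matrix.mul_assoc]
        _ = _ := by rw [r1, r2]; simp
    rw [e] at key
    simp only [det_mul, det_transpose] at key ⊢
    linarith
  · have e : ∑ l, ((R⁻¹).val * K l * L.val)ᵀ * ((R⁻¹).val * K l * L.val)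
        = L.valᵀ * (∑ l, (K l)ᵀ * (R.val * R.valᵀ)⁻¹ * K l) * L.val := by
      rw [Matrix.mul_sum, Matrix.sum_mul, hRinv]
      refine Finset.sum_congr rfl fun l _ => ?_
      simp only [transpose_mul, Matrix.mul_assoc]
    rw [e, h₂, hLinv]
    simp only [Matrix.mul_assoc]
    rw [hLi, Matrix.mul_one, hLi']
  · have e : ∑ l, ((R⁻¹).val * K l * L.val) * ((R⁻¹).val * K l * L.val)ᵀ
        = (R⁻¹).val * (∑ l, K l * (L.val * L.valᵀ) * (K l)ᵀ) * (R⁻¹).valᵀ := by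
      rw [Matrix.mul_sum, Matrix.sum_mul]
      refine Finset.sum_congr rfl fun l _ => ?_
      simp only [transpose_mul, Matrix.mul_assoc]
    rw [e, h₁]
    simp only [Matrix.mul_assoc]
    rw [hRi', Matrix.mul_one, hRi]
  · refine (hX.posSemidef.transpose_mul_mul_same R.val).posDef_of_det_ne_zero ?_
    have : R.val.det ≠ 0 := by
      simpa [isUnit_iff_ne_zero] using (isUnit_iff_isUnit_det _).1 R.isUnit
    simp only [det_mul, det_transpose]
    exact mul_ne_zero (mul_ne_zero this hX.det_pos.ne') this

end Kraus

namespace BipartiteQuiver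

/-! ### Block diagonal matrices with repeated blocks. -/

section BlockLift

variable {κ : Type*} [Fintype κ] [DecidableEq κ] {c b : κ → ℕ}

/-- The block diagonal matrix with `c k` copies of `S k` for each `k`. -/
noncomputable def blockLift (c : κ → ℕ) {b : κ → ℕ} (S : ∀ k, Matrix (Fin (b k)) (Fin (b k)) ℝ) :
    Matrix (Σ k, Fin (c k) × Fin (b k)) (Σ k, Fin (c k) × Fin (b k)) ℝ :=
  blockDiagonal' fun k => (1 : Matrix (Fin (c k)) (Fin (c k)) ℝ) ⊗ₖ S k

/-- The inclusion of the block `(k, q)`. -/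
def blockEmb (c b : κ → ℕ) (k : κ) (q : Fin (c k)) :
    Matrix (Σ k, Fin (c k) × Fin (b k)) (Fin (b k)) ℝ :=
  (1 : Matrix (Σ k, Fin (c k) × Fin (b k)) (Σ k, Fin (c k) × Fin (b k)) ℝ).submatrix id
    fun s => ⟨k, q, s⟩

theorem _root_.Matrix.det_blockDiagonal' {m : κ → Type*} [∀ k, Fintype (m k)]
    [∀ k, DecidableEq (m k)] (M : ∀ k, Matrix (m k) (m k) ℝ) :
    (blockDiagonal' M).det = ∏ k, (M k).det := by
  -- Any order will do: it only serves to regard the matrix as block triangular.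
  let _ : LinearOrder κ := LinearOrder.lift' (Fintype.equivFin κ) (Equiv.injective _)
  rw [(blockTriangular_blockDiagonal' M).det_fintype]
  refine Finset.prod_congr rfl fun k _ => ?_
  let e : m k ≃ {x : Σ k, m k // x.1 = k} :=
    { toFun := fun s => ⟨⟨k, s⟩, rfl⟩
      invFun := fun x => x.2 ▸ x.1.2
      left_inv := fun s => rfl
      right_inv := by rintro ⟨⟨k', s⟩, rfl⟩; rfl }
  rw [← det_submatrix_equiv_self e]
  congr 1
  ext s t
  exact blockDiagonal'_apply_eq M k s t

theorem det_blockLift (S : ∀ k, Matrix (Fin (b k)) (Fin (b k)) ℝ) :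
    (blockLift c S).det = ∏ k, (S k).det ^ c k := by
  simp [blockLift, Matrix.det_blockDiagonal', det_kronecker]

theorem blockLift_mul (S T : ∀ k, Matrix (Fin (b k)) (Fin (b k)) ℝ) :
    blockLift c S * blockLift c T = blockLift c fun k => S k * T k := by
  simp [blockLift, ← blockDiagonal'_mul, ← mul_kronecker_mul]

theorem blockLift_one :
    blockLift c (fun k => (1 : Matrix (Fin (b k)) (Fin (b k)) ℝ)) = 1 := by
  simp only [blockLift, one_kronecker_one]
  exact blockDiagonal'_one

theorem blockEmb_transpose_mul_blockLift_mul (S : ∀ k, Matrix (Fin (b k)) (Fin (b k)) ℝ) (k : κ)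
    (q : Fin (c k)) : (blockEmb c b k q)ᵀ * blockLift c S * blockEmb c b k q = S k := by
  have h : (blockEmb c b k q)ᵀ * blockLift c S * blockEmb c b k q
      = (blockLift c S).submatrix (fun s => ⟨k, q, s⟩) (fun s => ⟨k, q, s⟩) := by
    ext s t
    simp [blockEmb, Matrix.mul_apply, one_apply]
  rw [h]
  ext s t
  simp [blockLift, blockDiagonal'_apply_eq]

theorem sum_blockEmb_mul_mul_transpose (S : ∀ k, Matrix (Fin (b k)) (Fin (b k)) ℝ) :
    ∑ k, ∑ q, blockEmb c b k q * S k * (blockEmb c b k q)ᵀ = blockLift c S := by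
  ext ⟨k, q, s⟩ ⟨k', q', s'⟩
  simp only [Matrix.sum_apply]
  rw [Finset.sum_eq_single k, Finset.sum_eq_single q]
  · by_cases hk : k = k'
    · subst hk
      by_cases hq : q = q'
      · subst hq
        simp [blockEmb, Matrix.mul_apply, one_apply, blockLift, blockDiagonal'_apply_eq]
      · simp [blockEmb, Matrix.mul_apply, one_apply, blockLift, blockDiagonal'_apply_eq, hq]
    · rw [blockLift, blockDiagonal'_apply_ne _ _ _ hk]
      have : ∀ x : Fin (b k), (⟨k, q, x⟩ : Σ k, Fin (c k) × Fin (b k)) ≠ ⟨k', q', s'⟩ :=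
        fun x h => hk (congrArg Sigma.fst h)
      simp [blockEmb, Matrix.mul_apply, one_apply, this]
  · intro q₁ _ hq₁
    simp [blockEmb, Matrix.mul_apply, one_apply, Ne.symm hq₁]
  · simp
  · intro k₁ _ hk₁
    refine Finset.sum_eq_zero fun q₁ _ => ?_
    simp [blockEmb, Matrix.mul_apply, one_apply, Ne.symm hk₁]
  · simp

theorem blockLift_injective (hc : ∀ k, 0 < c k) :
    Function.Injective (blockLift c (b := b)) := by
  intro S T h
  ext1 k
  rw [← blockEmb_transpose_mul_blockLift_mul (c := c) S k ⟨0, hc k⟩, h,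
    blockEmb_transpose_mul_blockLift_mul]

theorem blockLift_posDef {S : ∀ k, Matrix (Fin (b k)) (Fin (b k)) ℝ} (hS : ∀ k, (S k).PosDef) :
    (blockLift c S).PosDef := by
  refine Matrix.PosSemidef.posDef_of_det_ne_zero ?_ ?_
  · rw [← sum_blockEmb_mul_mul_transpose]
    exact posSemidef_sum _ fun k _ => posSemidef_sum _ fun q _ =>
      (hS k).posSemidef.mul_mul_transpose_same _
  · rw [det_blockLift]
    exact Finset.prod_ne_zero_iff.2 fun k _ => pow_ne_zero _ (hS k).det_pos.ne'

theorem blockLift_inv {S : ∀ k, Matrix (Fin (b k)) (Fin (b k)) ℝ} (hS : ∀ k, (S k).PosDef) :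
    (blockLift c S)⁻¹ = blockLift c fun k => (S k)⁻¹ := by
  apply inv_eq_left_inv
  rw [blockLift_mul, ← blockLift_one (c := c) (b := b)]
  congr 1
  ext1 k
  exact nonsing_inv_mul _ ((isUnit_iff_isUnit_det _).1 (hS k).isUnit)

end BlockLift

/-! ### Push-forward and pull-back of forms along the arrows. -/

section Operators

variable {I J : Type*} {A : I → J → Type*} {β : I ⊕ J → ℕ}
variable [Fintype I] [Fintype J] [∀ i j, Fintype (A i j)]

/-- The matrices `∑ᵢ σ₊(i) ∑ₐ V(a) Sᵢ V(a)ᵀ` at the sinks. -/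
noncomputable def pushForm (V : Rep A β) (σ : I ⊕ J → ℤ)
    (S : ∀ i : I, Matrix (Fin (β (Sum.inl i))) (Fin (β (Sum.inl i))) ℝ) (j : J) :
    Matrix (Fin (β (Sum.inr j))) (Fin (β (Sum.inr j))) ℝ :=
  ∑ i, (sigmaPlus σ i : ℝ) • ∑ a : A i j, V i j a * S i * (V i j a)ᵀ

/-- The matrices `∑ⱼ σ₋(j) ∑ₐ V(a)ᵀ Yⱼ V(a)` at the sources. -/
noncomputable def pullForm (V : Rep A β) (σ : I ⊕ J → ℤ)
    (Y : ∀ j : J, Matrix (Fin (β (Sum.inr j))) (Fin (β (Sum.inr j))) ℝ) (i : I) :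
    Matrix (Fin (β (Sum.inl i))) (Fin (β (Sum.inl i))) ℝ :=
  ∑ j, (sigmaMinus σ j : ℝ) • ∑ a : A i j, (V i j a)ᵀ * Y j * V i j a

/-- `S` scales `(V, σ)` to a geometric datum. -/
structure IsBalanced (V : Rep A β) (σ : I ⊕ J → ℤ)
    (S : ∀ i : I, Matrix (Fin (β (Sum.inl i))) (Fin (β (Sum.inl i))) ℝ) : Prop where
  posDef : ∀ i, (S i).PosDef
  posDef_pushForm : ∀ j, (pushForm V σ S j).PosDef
  pullForm_inv : ∀ i, pullForm V σ (fun j => (pushForm V σ S j)⁻¹) i = (S i)⁻¹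

variable (V : Rep A β) (σ : I ⊕ J → ℤ)

theorem pushForm_posSemidef {S : ∀ i : I, Matrix (Fin (β (Sum.inl i))) (Fin (β (Sum.inl i))) ℝ}
    (hS : ∀ i, (S i).PosSemidef) (j : J) : (pushForm V σ S j).PosSemidef :=
  posSemidef_sum _ fun i _ => PosSemidef.smul (posSemidef_sum _ fun _ _ =>
    (hS i).mul_mul_transpose_same _) (Nat.cast_nonneg _)

theorem pullForm_posSemidef {Y : ∀ j : J, Matrix (Fin (β (Sum.inr j))) (Fin (β (Sum.inr j))) ℝ}
    (hY : ∀ j, (Y j).PosSemidef) (i : I) : (pullForm V σ Y i).PosSemidef :=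
  posSemidef_sum _ fun j _ => PosSemidef.smul (posSemidef_sum _ fun _ _ =>
    (hY j).transpose_mul_mul_same _) (Nat.cast_nonneg _)

theorem dotProduct_pushForm (S : ∀ i : I, Matrix (Fin (β (Sum.inl i))) (Fin (β (Sum.inl i))) ℝ)
    (j : J) (u : Fin (β (Sum.inr j)) → ℝ) :
    u ⬝ᵥ (pushForm V σ S j *ᵥ u) = ∑ i, (sigmaPlus σ i : ℝ) * ∑ a : A i j,
      ((V i j a)ᵀ *ᵥ u) ⬝ᵥ (S i *ᵥ ((V i j a)ᵀ *ᵥ u)) := by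
  rw [pushForm, sum_mulVec, dotProduct_sum]
  refine Finset.sum_congr rfl fun i _ => ?_
  rw [smul_mulVec, dotProduct_smul, smul_eq_mul, sum_mulVec, dotProduct_sum]
  congr 1
  refine Finset.sum_congr rfl fun a _ => ?_
  rw [← mulVec_mulVec, ← mulVec_mulVec, dotProduct_mulVec, ← mulVec_transpose]

theorem dotProduct_pullForm (Y : ∀ j : J, Matrix (Fin (β (Sum.inr j))) (Fin (β (Sum.inr j))) ℝ)
    (i : I) (u : Fin (β (Sum.inl i)) → ℝ) :
    u ⬝ᵥ (pullForm V σ Y i *ᵥ u) = ∑ j, (sigmaMinus σ j : ℝ) * ∑ a : A i j,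
      (V i j a *ᵥ u) ⬝ᵥ (Y j *ᵥ (V i j a *ᵥ u)) := by
  rw [pullForm, sum_mulVec, dotProduct_sum]
  refine Finset.sum_congr rfl fun j _ => ?_
  rw [smul_mulVec, dotProduct_smul, smul_eq_mul, sum_mulVec, dotProduct_sum]
  congr 1
  refine Finset.sum_congr rfl fun a _ => ?_
  rw [← mulVec_mulVec, ← mulVec_mulVec, dotProduct_mulVec, vecMul_transpose]

variable {V σ}

/-- The quadratic form at `u` is a nonnegative combination of the values of the `S i` on the vectors
`V(a)ᵀ u`, so a single nonzero such vector suffices. -/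
theorem pushForm_posDef (hσ : ∀ i, 0 < σ (Sum.inl i))
    {S : ∀ i : I, Matrix (Fin (β (Sum.inl i))) (Fin (β (Sum.inl i))) ℝ}
    (hS : ∀ i, (S i).PosDef) {j : J}
    (h : ∀ u : Fin (β (Sum.inr j)) → ℝ, u ≠ 0 → ∃ i, ∃ a : A i j, (V i j a)ᵀ *ᵥ u ≠ 0) :
    (pushForm V σ S j).PosDef := by
  refine PosDef.of_dotProduct_mulVec_pos
    (pushForm_posSemidef V σ (fun i => (hS i).posSemidef) j).1 fun u hu => ?_
  rw [star_trivial, dotProduct_pushForm]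
  obtain ⟨i, a, ha⟩ := h u hu
  have hnn : ∀ i, ∀ a : A i j, 0 ≤ ((V i j a)ᵀ *ᵥ u) ⬝ᵥ (S i *ᵥ ((V i j a)ᵀ *ᵥ u)) := fun i a => by
    simpa using (hS i).posSemidef.dotProduct_mulVec_nonneg ((V i j a)ᵀ *ᵥ u)
  refine Finset.sum_pos' (fun i _ => mul_nonneg (Nat.cast_nonneg _)
    (Finset.sum_nonneg fun a _ => hnn i a)) ⟨i, Finset.mem_univ i, mul_pos ?_ ?_⟩
  · have := hσ i
    simp only [sigmaPlus, Nat.cast_pos]; omega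
  · exact Finset.sum_pos' (fun a _ => hnn i a) ⟨a, Finset.mem_univ a, by
      simpa using (hS i).dotProduct_mulVec_pos ha⟩

theorem pullForm_posDef (hσ : ∀ j, σ (Sum.inr j) < 0)
    {Y : ∀ j : J, Matrix (Fin (β (Sum.inr j))) (Fin (β (Sum.inr j))) ℝ}
    (hY : ∀ j, (Y j).PosDef) {i : I}
    (h : ∀ u : Fin (β (Sum.inl i)) → ℝ, u ≠ 0 → ∃ j, ∃ a : A i j, V i j a *ᵥ u ≠ 0) :
    (pullForm V σ Y i).PosDef := by
  refine PosDef.of_dotProduct_mulVec_pos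
    (pullForm_posSemidef V σ (fun i => (hY i).posSemidef) i).1 fun u hu => ?_
  rw [star_trivial, dotProduct_pullForm]
  obtain ⟨j, a, ha⟩ := h u hu
  have hnn : ∀ j, ∀ a : A i j, 0 ≤ (V i j a *ᵥ u) ⬝ᵥ (Y j *ᵥ (V i j a *ᵥ u)) := fun j a => by
    simpa using (hY j).posSemidef.dotProduct_mulVec_nonneg (V i j a *ᵥ u)
  refine Finset.sum_pos' (fun j _ => mul_nonneg (Nat.cast_nonneg _)
    (Finset.sum_nonneg fun a _ => hnn j a)) ⟨j, Finset.mem_univ j, mul_pos ?_ ?_⟩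
  · have := hσ j
    simp only [sigmaMinus, Nat.cast_pos]; omega
  · exact Finset.sum_pos' (fun a _ => hnn j a) ⟨a, Finset.mem_univ a, by
      simpa using (hY j).dotProduct_mulVec_pos ha⟩

/-- A vector killed by all the transposes is orthogonal to every image, hence to the whole space. -/
theorem SpansSinks.exists_transpose_mulVec_ne_zero (h : SpansSinks V) {j : J}
    {u : Fin (β (Sum.inr j)) → ℝ} (hu : u ≠ 0) : ∃ i, ∃ a : A i j, (V i j a)ᵀ *ᵥ u ≠ 0 := by
  by_contra! h0
  apply hu
  have hle : ⨆ i, ⨆ a : A i j, LinearMap.range (V i j a).mulVecLin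
      ≤ LinearMap.ker (dotProductBilin ℝ ℝ u) := by
    refine iSup_le fun i => iSup_le fun a => ?_
    rintro _ ⟨x, rfl⟩
    simp only [LinearMap.mem_ker, dotProductBilin_apply_apply, mulVecLin_apply]
    rw [dotProduct_mulVec, ← mulVec_transpose, h0, zero_dotProduct]
  rw [h j] at hle
  have := hle (Submodule.mem_top (x := u))
  simpa using this

/-- If the images fail to span, a nonzero functional vanishing on all of them is represented by a
null vector `u` of the form. -/
theorem spansSinks_of_posDef_pushForm
    {S : ∀ i : I, Matrix (Fin (β (Sum.inl i))) (Fin (β (Sum.inl i))) ℝ}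
    (h : ∀ j, (pushForm V σ S j).PosDef) : SpansSinks V := by
  intro j
  by_contra hne
  obtain ⟨f, hf, hle⟩ := Submodule.exists_le_ker_of_lt_top _ (lt_top_iff_ne_top.2 hne)
  set u : Fin (β (Sum.inr j)) → ℝ := fun s => f (Pi.single s 1) with hu
  have hfu : ∀ x, f x = u ⬝ᵥ x := by
    intro x
    conv_lhs => rw [pi_eq_sum_univ x]
    simp only [map_sum, map_smul, smul_eq_mul, dotProduct, hu]
    refine Finset.sum_congr rfl fun s _ => ?_
    rw [mul_comm]
    congr 2
    ext t
    simp [Pi.single_apply, eq_comm]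
  have hu0 : u ≠ 0 := by
    rintro h0
    apply hf
    ext x
    simp [hfu, h0]
  have hV : ∀ i, ∀ a : A i j, (V i j a)ᵀ *ᵥ u = 0 := by
    intro i a
    have : ∀ x, ((V i j a)ᵀ *ᵥ u) ⬝ᵥ x = 0 := by
      intro x
      rw [mulVec_transpose, ← dotProduct_mulVec, ← hfu]
      exact hle (Submodule.mem_iSup_of_mem i (Submodule.mem_iSup_of_mem a ⟨x, rfl⟩))
    exact dotProduct_eq_zero _ this
  have := (h j).dotProduct_mulVec_pos hu0
  rw [star_trivial, dotProduct_pushForm] at this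
  simp [hV] at this

end Operators

/-! ### Capacity, and balanced tuples as extremizers. -/

section Capacity

variable {I J : Type*} {A : I → J → Type*} {β : I ⊕ J → ℕ}
variable [Fintype I] [Fintype J] [DecidableEq I] [DecidableEq J] [∀ i j, Fintype (A i j)]

/-- The index type of the Kraus operators. -/
abbrev KrausIdx (A : I → J → Type*) (σ : I ⊕ J → ℤ) :=
  Σ i : I, Σ j : J, A i j × Fin (sigmaMinus σ j) × Fin (sigmaPlus σ i)

/-- The family of all Kraus operators. -/
noncomputable def krausFamily (V : Rep A β) (σ : I ⊕ J → ℤ) (l : KrausIdx A σ) :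
    Matrix (RowIdx β σ) (ColIdx β σ) ℝ :=
  kraus V σ l.1 l.2.1 l.2.2.1 l.2.2.2.1 l.2.2.2.2

variable (V : Rep A β) (σ : I ⊕ J → ℤ)

theorem sum_krausIdx {M : Type*} [AddCommMonoid M] (f : KrausIdx A σ → M) :
    ∑ l, f l = ∑ i, ∑ j, ∑ a : A i j, ∑ q, ∑ r, f ⟨i, j, a, q, r⟩ := by
  simp only [Fintype.sum_sigma, Fintype.sum_prod_type]

theorem blOperator_eq_sum (X : Matrix (RowIdx β σ) (RowIdx β σ) ℝ) :
    blOperator V σ X = ∑ l, (krausFamily V σ l)ᵀ * X * krausFamily V σ l := by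
  rw [sum_krausIdx]; rfl

/-- Factoring through the block inclusions reduces every sum over Kraus operators to computations
with single blocks. -/
theorem kraus_eq (i : I) (j : J) (a : A i j) (q : Fin (sigmaMinus σ j)) (r : Fin (sigmaPlus σ i)) :
    kraus V σ i j a q r = blockEmb (sigmaMinus σ) (fun j => β (Sum.inr j)) j q * V i j a *
      (blockEmb (sigmaPlus σ) (fun i => β (Sum.inl i)) i r)ᵀ := by
  ext x y
  simp only [kraus, Matrix.sum_apply, Matrix.mul_apply, blockEmb, submatrix_apply, transpose_apply,
    one_apply, id, single_apply, Finset.sum_mul]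
  rw [Finset.sum_comm]
  refine Finset.sum_congr rfl fun u _ => Finset.sum_congr rfl fun s _ => ?_
  by_cases h₁ : x = ⟨j, q, s⟩ <;> by_cases h₂ : y = ⟨i, r, u⟩ <;>
    simp [h₁, h₂, eq_comm]

/-- The summand does not depend on the column block `r`, whose `σ₊(i)` values give the coefficient
in `pushForm`; the row blocks `q` give the repeated diagonal blocks. `blOperator_blockLift` is the
dual computation. -/
theorem sum_krausFamily_mul_blockLift
    (S : ∀ i : I, Matrix (Fin (β (Sum.inl i))) (Fin (β (Sum.inl i))) ℝ) :
    ∑ l, krausFamily V σ l * blockLift (sigmaPlus σ) S * (krausFamily V σ l)ᵀ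
      = blockLift (sigmaMinus σ) (pushForm V σ S) := by
  rw [sum_krausIdx, ← sum_blockEmb_mul_mul_transpose (pushForm V σ S), Finset.sum_comm]
  refine Finset.sum_congr rfl fun j _ => ?_
  have h : ∀ i, ∀ a : A i j, ∀ q r, krausFamily V σ ⟨i, j, a, q, r⟩ * blockLift (sigmaPlus σ) S *
      (krausFamily V σ ⟨i, j, a, q, r⟩)ᵀ = blockEmb (sigmaMinus σ) (fun j => β (Sum.inr j)) j q *
        (V i j a * S i * (V i j a)ᵀ) *
        (blockEmb (sigmaMinus σ) (fun j => β (Sum.inr j)) j q)ᵀ := by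
    intro i a q r
    simp only [krausFamily, kraus_eq]
    conv_rhs => rw [← blockEmb_transpose_mul_blockLift_mul (c := sigmaPlus σ) S i r]
    simp only [transpose_mul, transpose_transpose, Matrix.mul_assoc]
  simp only [h, Finset.sum_const, Finset.card_univ, Fintype.card_fin]
  have h2 : ∀ i, ∑ a : A i j, ∑ q, sigmaPlus σ i •
      (blockEmb (sigmaMinus σ) (fun j => β (Sum.inr j)) j q * (V i j a * S i * (V i j a)ᵀ) *
        (blockEmb (sigmaMinus σ) (fun j => β (Sum.inr j)) j q)ᵀ)
      = ∑ q, blockEmb (sigmaMinus σ) (fun j => β (Sum.inr j)) j q *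
        ((sigmaPlus σ i : ℝ) • ∑ a : A i j, V i j a * S i * (V i j a)ᵀ) *
        (blockEmb (sigmaMinus σ) (fun j => β (Sum.inr j)) j q)ᵀ := by
    intro i
    rw [Finset.sum_comm]
    refine Finset.sum_congr rfl fun q _ => ?_
    rw [Matrix.mul_smul, Matrix.smul_mul, Matrix.mul_sum, Matrix.sum_mul, Finset.smul_sum]
    simp only [Nat.cast_smul_eq_nsmul]
  simp only [h2]
  rw [Finset.sum_comm]
  refine Finset.sum_congr rfl fun q _ => ?_
  rw [pushForm, Matrix.mul_sum, Matrix.sum_mul]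

theorem blOperator_blockLift
    (Y : ∀ j : J, Matrix (Fin (β (Sum.inr j))) (Fin (β (Sum.inr j))) ℝ) :
    blOperator V σ (blockLift (sigmaMinus σ) Y) = blockLift (sigmaPlus σ) (pullForm V σ Y) := by
  rw [blOperator, ← sum_blockEmb_mul_mul_transpose (pullForm V σ Y)]
  refine Finset.sum_congr rfl fun i _ => ?_
  have h : ∀ j, ∀ a : A i j, ∀ q r, (kraus V σ i j a q r)ᵀ * blockLift (sigmaMinus σ) Y *
      kraus V σ i j a q r = blockEmb (sigmaPlus σ) (fun i => β (Sum.inl i)) i r *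
        ((V i j a)ᵀ * Y j * V i j a) *
        (blockEmb (sigmaPlus σ) (fun i => β (Sum.inl i)) i r)ᵀ := by
    intro j a q r
    simp only [kraus_eq]
    conv_rhs => rw [← blockEmb_transpose_mul_blockLift_mul (c := sigmaMinus σ) Y j q]
    simp only [transpose_mul, transpose_transpose, Matrix.mul_assoc]
  simp only [h, Finset.sum_const, Finset.card_univ, Fintype.card_fin]
  have h2 : ∀ j, ∑ a : A i j, sigmaMinus σ j • ∑ r,
      (blockEmb (sigmaPlus σ) (fun i => β (Sum.inl i)) i r * ((V i j a)ᵀ * Y j * V i j a) *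
        (blockEmb (sigmaPlus σ) (fun i => β (Sum.inl i)) i r)ᵀ)
      = ∑ r, blockEmb (sigmaPlus σ) (fun i => β (Sum.inl i)) i r *
        ((sigmaMinus σ j : ℝ) • ∑ a : A i j, (V i j a)ᵀ * Y j * V i j a) *
        (blockEmb (sigmaPlus σ) (fun i => β (Sum.inl i)) i r)ᵀ := by
    intro j
    simp only [Finset.smul_sum]
    rw [Finset.sum_comm]
    refine Finset.sum_congr rfl fun r _ => ?_
    rw [Matrix.mul_sum, Matrix.sum_mul]
    simp only [Matrix.mul_smul, Matrix.smul_mul, Nat.cast_smul_eq_nsmul]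
  simp only [h2]
  rw [Finset.sum_comm]
  refine Finset.sum_congr rfl fun r _ => ?_
  rw [pullForm, Matrix.mul_sum, Matrix.sum_mul]

theorem capAt_eq (S : ∀ i : I, Matrix (Fin (β (Sum.inl i))) (Fin (β (Sum.inl i))) ℝ) :
    capAt V σ S = (blockLift (sigmaMinus σ) (pushForm V σ S)).det /
      (blockLift (sigmaPlus σ) S).det := by
  rw [det_blockLift, det_blockLift]; rfl

/-- The operator and the map with transposed Kraus operators are adjoint for the trace pairing. -/
theorem trace_blOperator_mul (X : Matrix (RowIdx β σ) (RowIdx β σ) ℝ)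
    (Y : Matrix (ColIdx β σ) (ColIdx β σ) ℝ) :
    (blOperator V σ X * Y).trace
      = (X * ∑ l, krausFamily V σ l * Y * (krausFamily V σ l)ᵀ).trace := by
  rw [blOperator_eq_sum, Matrix.sum_mul, Matrix.mul_sum, trace_sum, trace_sum]
  refine Finset.sum_congr rfl fun l _ => ?_
  rw [Matrix.mul_assoc, Matrix.mul_assoc, trace_mul_comm]
  simp only [Matrix.mul_assoc]

theorem blOperator_posSemidef {X : Matrix (RowIdx β σ) (RowIdx β σ) ℝ} (hX : X.PosSemidef) :
    (blOperator V σ X).PosSemidef := by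
  rw [blOperator_eq_sum]
  exact posSemidef_sum _ fun l _ => hX.transpose_mul_mul_same _

variable {V σ}

theorem card_rowIdx_eq (hσp : ∀ i, 0 < σ (Sum.inl i)) (hσn : ∀ j, σ (Sum.inr j) < 0)
    (hσβ : ∑ x, σ x * (β x : ℤ) = 0) :
    Fintype.card (RowIdx β σ) = Fintype.card (ColIdx β σ) := by
  simp only [Fintype.card_sigma, Fintype.card_prod, Fintype.card_fin]
  rw [Fintype.sum_sum_type] at hσβ
  zify
  have h1 : ∀ i, (sigmaPlus σ i : ℤ) = σ (Sum.inl i) := fun i => Int.toNat_of_nonneg (hσp i).le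
  have h2 : ∀ j, (sigmaMinus σ j : ℤ) = - σ (Sum.inr j) := fun j =>
    Int.toNat_of_nonneg (by linarith [hσn j])
  simp only [h1, h2, neg_mul, Finset.sum_neg_distrib]
  linarith

/-- Both sides are homogeneous in `X` of the same degree, because there are as many rows as columns;
so `X` can be rescaled to determinant 1. -/
theorem cap_mul_det_le (hc : Fintype.card (RowIdx β σ) = Fintype.card (ColIdx β σ))
    {X : Matrix (RowIdx β σ) (RowIdx β σ) ℝ} (hX : X.PosDef) :
    cap V σ * X.det ≤ (blOperator V σ X).det := by
  obtain ⟨c, hc0, hcX⟩ : ∃ c : ℝ, 0 < c ∧ c ^ Fintype.card (RowIdx β σ) * X.det = 1 := by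
    -- With an empty index type the determinant is already 1 and no root can be taken.
    rcases Nat.eq_zero_or_pos (Fintype.card (RowIdx β σ)) with h | h
    · have := Fintype.card_eq_zero_iff.1 h
      exact ⟨1, one_pos, by simp⟩
    · refine ⟨X.det⁻¹ ^ ((Fintype.card (RowIdx β σ) : ℝ)⁻¹),
        Real.rpow_pos_of_pos (inv_pos.2 hX.det_pos) _, ?_⟩
      rw [Real.rpow_inv_natCast_pow (inv_pos.2 hX.det_pos).le h.ne',
        inv_mul_cancel₀ hX.det_pos.ne']
  have hbl : blOperator V σ (c • X) = c • blOperator V σ X := by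
    simp only [blOperator_eq_sum, Finset.smul_sum, Matrix.mul_smul, Matrix.smul_mul]
  have hle : cap V σ ≤ (blOperator V σ (c • X)).det := by
    refine csInf_le ⟨0, ?_⟩ ⟨c • X, PosDef.smul hX hc0, by rw [det_smul, hcX], rfl⟩
    rintro _ ⟨Z, hZ, -, rfl⟩
    exact (blOperator_posSemidef V σ hZ.posSemidef).det_nonneg
  rw [hbl, det_smul, ← hc] at hle
  calc cap V σ * X.det ≤ c ^ Fintype.card (RowIdx β σ) * (blOperator V σ X).det * X.det :=
        mul_le_mul_of_nonneg_right hle hX.det_pos.le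
    _ = (c ^ Fintype.card (RowIdx β σ) * X.det) * (blOperator V σ X).det := by ring
    _ = _ := by rw [hcX, one_mul]

theorem sigmaPlus_pos (hσ : ∀ i, 0 < σ (Sum.inl i)) (i : I) : 0 < sigmaPlus σ i := by
  have := hσ i
  simp only [sigmaPlus]; omega

/-- If the pulled back inverse form has large enough determinant, then `S` is balanced. -/
theorem isBalanced_of_one_le_det (hσp : ∀ i, 0 < σ (Sum.inl i))
    (hc : Fintype.card (RowIdx β σ) = Fintype.card (ColIdx β σ))
    {S : ∀ i : I, Matrix (Fin (β (Sum.inl i))) (Fin (β (Sum.inl i))) ℝ}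
    (hS : ∀ i, (S i).PosDef) (hP : ∀ j, (pushForm V σ S j).PosDef)
    (hdet : 1 ≤ (blOperator V σ (blockLift (sigmaMinus σ) (pushForm V σ S))⁻¹ *
      blockLift (sigmaPlus σ) S).det) : IsBalanced V σ S := by
  refine ⟨hS, hP, ?_⟩
  have hQ := blockLift_posDef (c := sigmaMinus σ) hP
  have h := (blOperator_posSemidef V σ hQ.inv.posSemidef).mul_eq_one_of_trace_eq
    (blockLift_posDef hS) ?_ hdet
  · have h' := inv_eq_left_inv h
    rw [blockLift_inv hP, blOperator_blockLift, blockLift_inv hS] at h'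
    have := blockLift_injective (sigmaPlus_pos hσp) h'
    exact fun i => (congrFun this i).symm
  -- By adjointness this is the trace of `Q⁻¹ Q`, so the equality case of AM-GM applies.
  · rw [trace_blOperator_mul, sum_krausFamily_mul_blockLift,
      nonsing_inv_mul _ ((isUnit_iff_isUnit_det _).1 hQ.isUnit), trace_one, hc]

theorem IsBalanced.isGaussianExtremizer
    (hc : Fintype.card (RowIdx β σ) = Fintype.card (ColIdx β σ))
    {S : ∀ i : I, Matrix (Fin (β (Sum.inl i))) (Fin (β (Sum.inl i))) ℝ}
    (h : IsBalanced V σ S) : IsGaussianExtremizer V σ S := by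
  have hS := blockLift_posDef (c := sigmaPlus σ) h.posDef
  have hQ := blockLift_posDef (c := sigmaMinus σ) h.posDef_pushForm
  have hpull : blOperator V σ (blockLift (sigmaMinus σ) (pushForm V σ S))⁻¹
      = (blockLift (sigmaPlus σ) S)⁻¹ := by
    rw [blockLift_inv h.posDef_pushForm, blOperator_blockLift, blockLift_inv h.posDef]
    congr 1
    exact funext h.pullForm_inv
  refine ⟨h.posDef, le_antisymm ?_ ?_⟩
  -- The test matrix `Q⁻¹` is sent to `S⁻¹`, which gives the upper bound; below, the scaling
  -- inequality bounds the determinant for every competitor.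
  · have := cap_mul_det_le (V := V) hc hQ.inv
    rw [hpull, det_nonsing_inv, det_nonsing_inv, Ring.inverse_eq_inv, Ring.inverse_eq_inv] at this
    rw [capAt_eq]
    rw [← div_eq_mul_inv, div_le_iff₀ hQ.det_pos] at this
    rw [div_eq_inv_mul]; exact this
  · refine le_csInf ⟨_, 1, PosDef.one, det_one, rfl⟩ ?_
    rintro _ ⟨X, hX, hX1, rfl⟩
    rw [blOperator_eq_sum] at hpull
    have := det_mul_det_le_of_scaling (krausFamily V σ) hS hQ
      (sum_krausFamily_mul_blockLift V σ S) hpull hX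
    rw [hX1, one_mul, ← blOperator_eq_sum] at this
    rw [capAt_eq, div_le_iff₀ hS.det_pos]
    exact this

/-- Testing the capacity at `Q⁻¹` and inserting its value `det Q / det S` gives the determinant
bound required by `isBalanced_of_one_le_det`. -/
theorem IsGaussianExtremizer.isBalanced (hσp : ∀ i, 0 < σ (Sum.inl i))
    (hc : Fintype.card (RowIdx β σ) = Fintype.card (ColIdx β σ)) (hsp : SpansSinks V)
    {S : ∀ i : I, Matrix (Fin (β (Sum.inl i))) (Fin (β (Sum.inl i))) ℝ}
    (h : IsGaussianExtremizer V σ S) : IsBalanced V σ S := by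
  have hP : ∀ j, (pushForm V σ S j).PosDef := fun j =>
    pushForm_posDef hσp h.1 fun u hu => hsp.exists_transpose_mulVec_ne_zero hu
  have hS := blockLift_posDef (c := sigmaPlus σ) h.1
  have hQ := blockLift_posDef (c := sigmaMinus σ) hP
  refine isBalanced_of_one_le_det hσp hc h.1 hP ?_
  have := cap_mul_det_le (V := V) hc hQ.inv
  rw [h.2, capAt_eq, det_nonsing_inv, Ring.inverse_eq_inv, div_mul_eq_mul_div,
    mul_inv_cancel₀ hQ.det_pos.ne', div_le_iff₀ hS.det_pos] at this
  rwa [det_mul]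

end Capacity

/-! ### Balanced tuples and base changes to geometric data. -/

section Geometric

variable {I J : Type*} {A : I → J → Type*} {β : I ⊕ J → ℕ}
variable [Fintype I] [Fintype J] [∀ i j, Fintype (A i j)] {V : Rep A β} {σ : I ⊕ J → ℤ}

theorem pushForm_act (g : GLβ β) (j : J) :
    ∑ i, (sigmaPlus σ i : ℝ) • ∑ a : A i j, act g V i j a * (act g V i j a)ᵀ
      = (g (Sum.inr j)).val * pushForm V σ (fun i => ((g (Sum.inl i))⁻¹).val *
        ((g (Sum.inl i))⁻¹).valᵀ) j * (g (Sum.inr j)).valᵀ := by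
  simp only [pushForm, act, Matrix.mul_sum, Matrix.sum_mul, Matrix.mul_smul, Matrix.smul_mul,
    transpose_mul, Matrix.mul_assoc]

theorem pullForm_act (g : GLβ β) (i : I) :
    ∑ j, (sigmaMinus σ j : ℝ) • ∑ a : A i j, (act g V i j a)ᵀ * act g V i j a
      = ((g (Sum.inl i))⁻¹).valᵀ * pullForm V σ (fun j => (g (Sum.inr j)).valᵀ *
        (g (Sum.inr j)).val) i * ((g (Sum.inl i))⁻¹).val := by
  simp only [pullForm, act, Matrix.mul_sum, Matrix.sum_mul, Matrix.mul_smul, Matrix.smul_mul,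
    transpose_mul, Matrix.mul_assoc]

theorem mul_mul_transpose_eq_one_iff {n : Type*} [Fintype n] [DecidableEq n] (L : GL n ℝ)
    (M : Matrix n n ℝ) : L.val * M * L.valᵀ = 1 ↔ M = (L⁻¹).val * (L⁻¹).valᵀ := by
  have h : (L⁻¹).val * L.val = 1 := by simp
  have h' : L.val * (L⁻¹).val = 1 := by simp
  have ht : L.valᵀ * (L⁻¹).valᵀ = 1 := by rw [← transpose_mul, h, transpose_one]
  have ht' : (L⁻¹).valᵀ * L.valᵀ = 1 := by rw [← transpose_mul, h', transpose_one]
  constructor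
  · intro e
    calc M = ((L⁻¹).val * L.val) * M * (L.valᵀ * (L⁻¹).valᵀ) := by
          rw [h, ht, Matrix.one_mul, Matrix.mul_one]
      _ = (L⁻¹).val * (L.val * M * L.valᵀ) * (L⁻¹).valᵀ := by simp only [Matrix.mul_assoc]
      _ = _ := by rw [e, Matrix.mul_one]
  · rintro rfl
    calc _ = (L.val * (L⁻¹).val) * ((L⁻¹).valᵀ * L.valᵀ) := by simp only [Matrix.mul_assoc]
      _ = 1 := by rw [h', ht', Matrix.one_mul]

theorem transpose_mul_mul_eq_one_iff {n : Type*} [Fintype n] [DecidableEq n] (L : GL n ℝ)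
    (M : Matrix n n ℝ) : L.valᵀ * M * L.val = 1 ↔ M = (L⁻¹).valᵀ * (L⁻¹).val := by
  have h : (L⁻¹).val * L.val = 1 := by simp
  have h' : L.val * (L⁻¹).val = 1 := by simp
  have ht : L.valᵀ * (L⁻¹).valᵀ = 1 := by rw [← transpose_mul, h, transpose_one]
  have ht' : (L⁻¹).valᵀ * L.valᵀ = 1 := by rw [← transpose_mul, h', transpose_one]
  constructor
  · intro e
    calc M = ((L⁻¹).valᵀ * L.valᵀ) * M * (L.val * (L⁻¹).val) := by
          rw [h', ht', Matrix.one_mul, Matrix.mul_one]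
      _ = (L⁻¹).valᵀ * (L.valᵀ * M * L.val) * (L⁻¹).val := by simp only [Matrix.mul_assoc]
      _ = _ := by rw [e, Matrix.mul_one]
  · rintro rfl
    calc _ = (L.valᵀ * (L⁻¹).valᵀ) * ((L⁻¹).val * L.val) := by simp only [Matrix.mul_assoc]
      _ = 1 := by rw [h, ht, Matrix.one_mul]

/-- Balanced tuples are those induced by base changes that make the datum geometric. -/
theorem isBalanced_iff {S : ∀ i : I, Matrix (Fin (β (Sum.inl i))) (Fin (β (Sum.inl i))) ℝ} :
    IsBalanced V σ S ↔ ∃ g ∈ geometrizers V σ, S = fun i =>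
      ((g (Sum.inl i))⁻¹).val * ((g (Sum.inl i))⁻¹).valᵀ := by
  constructor
  · intro h
    choose L hL using fun i => (h.posDef i).exists_eq_mul_transpose
    choose R hR using fun j => (h.posDef_pushForm j).exists_eq_mul_transpose
    have hSL : S = fun i => (((L i)⁻¹)⁻¹).val * (((L i)⁻¹)⁻¹).valᵀ := by
      ext1 i; rw [inv_inv, hL i]
    refine ⟨fun x => match x with | Sum.inl i => (L i)⁻¹ | Sum.inr j => (R j)⁻¹, ⟨?_, ?_⟩, hSL⟩
    · intro i
      rw [pullForm_act]
      refine (transpose_mul_mul_eq_one_iff (((L i)⁻¹)⁻¹) _).2 ?_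
      rw [inv_inv, ← inv_mul_transpose_eq, ← hL, ← h.pullForm_inv i]
      congr 1
      ext1 j
      rw [hR j, inv_mul_transpose_eq]
    · intro j
      rw [pushForm_act]
      refine (mul_mul_transpose_eq_one_iff ((R j)⁻¹) _).2 ?_
      rw [inv_inv, ← hR j]
      congr 1
      exact hSL.symm
  · rintro ⟨g, ⟨h1, h2⟩, rfl⟩
    have hM : ∀ j, pushForm V σ (fun i => ((g (Sum.inl i))⁻¹).val * ((g (Sum.inl i))⁻¹).valᵀ) j
        = ((g (Sum.inr j))⁻¹).val * ((g (Sum.inr j))⁻¹).valᵀ := by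
      intro j
      have := h2 j
      rw [pushForm_act] at this
      exact (mul_mul_transpose_eq_one_iff _ _).1 this
    refine ⟨fun i => posDef_mul_transpose _, fun j => ?_, fun i => ?_⟩
    · rw [hM]; exact posDef_mul_transpose _
    · have := h1 i
      rw [pullForm_act] at this
      rw [inv_mul_transpose_eq, ← (transpose_mul_mul_eq_one_iff _ _).1 this]
      congr 1
      ext1 j
      rw [hM, inv_mul_transpose_eq, inv_inv]

end Geometric

/-! ### Subrepresentations, morphisms and weights. -/

section SubRep

variable {I J : Type*} {A : I → J → Type*} {β γ : I ⊕ J → ℕ}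

/-- The image of a subrepresentation under a morphism of representations. -/
def SubRep.map {V : Rep A β} {U : Rep A γ} (h : ∀ x, Matrix (Fin (γ x)) (Fin (β x)) ℝ)
    (hh : ∀ i j a, h (Sum.inr j) * V i j a = U i j a * h (Sum.inl i)) (W : SubRep V) :
    SubRep U where
  space x := (W.space x).map (h x).mulVecLin
  map_mem := by
    rintro i j a _ ⟨u, hu, rfl⟩
    refine ⟨V i j a *ᵥ u, W.map_mem i j a u hu, ?_⟩
    simp only [mulVecLin_apply, mulVec_mulVec, hh]

/-- The preimage of a subrepresentation under a morphism of representations. -/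
def SubRep.comap {V : Rep A β} {U : Rep A γ} (h : ∀ x, Matrix (Fin (γ x)) (Fin (β x)) ℝ)
    (hh : ∀ i j a, h (Sum.inr j) * V i j a = U i j a * h (Sum.inl i)) (W : SubRep U) :
    SubRep V where
  space x := (W.space x).comap (h x).mulVecLin
  map_mem := by
    intro i j a u hu
    have := W.map_mem i j a _ hu
    simpa only [Submodule.mem_comap, mulVecLin_apply, mulVec_mulVec, hh] using this

/-- The intersection of two subrepresentations. -/
def SubRep.inter {V : Rep A β} (W W' : SubRep V) : SubRep V where
  space x := W.space x ⊓ W'.space x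
  map_mem i j a u hu := ⟨W.map_mem i j a u hu.1, W'.map_mem i j a u hu.2⟩

/-- The whole representation. -/
def SubRep.univ (V : Rep A β) : SubRep V where
  space _ := ⊤
  map_mem _ _ _ _ _ := Submodule.mem_top

/-- The zero subrepresentation. -/
def SubRep.zero (V : Rep A β) : SubRep V where
  space _ := ⊥
  map_mem i j a u hu := by simp_all

variable [Fintype I] [Fintype J] {σ : I ⊕ J → ℤ} {V : Rep A β}

theorem finrank_univ_space (V : Rep A β) (x : I ⊕ J) :
    Module.finrank ℝ ((SubRep.univ V).space x) = β x :=
  (finrank_top ℝ (Fin (β x) → ℝ)).trans (Module.finrank_fin_fun ℝ)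

theorem weight_univ (hσβ : ∑ x, σ x * (β x : ℤ) = 0) : weight σ (SubRep.univ V) = 0 := by
  simpa only [weight, finrank_univ_space] using hσβ

theorem weight_map {U : Rep A γ} (h : ∀ x, Matrix (Fin (γ x)) (Fin (β x)) ℝ)
    (hh : ∀ i j a, h (Sum.inr j) * V i j a = U i j a * h (Sum.inl i))
    (hinj : ∀ x, Function.Injective (h x).mulVecLin) (W : SubRep V) :
    weight σ (W.map h hh) = weight σ W := by
  refine Finset.sum_congr rfl fun x _ => ?_
  congr 2
  exact (Submodule.equivMapOfInjective _ (hinj x) (W.space x)).finrank_eq.symm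

/-- Rank-nullity for a morphism of representations. -/
theorem weight_ker_add_weight_range {U : Rep A γ} (h : ∀ x, Matrix (Fin (γ x)) (Fin (β x)) ℝ)
    (hh : ∀ i j a, h (Sum.inr j) * V i j a = U i j a * h (Sum.inl i)) :
    weight σ ((SubRep.zero U).comap h hh) + weight σ ((SubRep.univ V).map h hh)
      = weight σ (SubRep.univ V) := by
  simp only [weight, ← Finset.sum_add_distrib, ← mul_add]
  refine Finset.sum_congr rfl fun x _ => ?_
  congr 1
  have h1 : (SubRep.comap h hh (SubRep.zero U)).space x = LinearMap.ker (h x).mulVecLin :=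
    Submodule.comap_bot _
  have h2 : (SubRep.map h hh (SubRep.univ V)).space x = LinearMap.range (h x).mulVecLin :=
    Submodule.map_top _
  rw [h1, h2, finrank_univ_space, add_comm]
  have := LinearMap.finrank_range_add_finrank_ker (h x).mulVecLin
  rw [Module.finrank_fin_fun] at this
  exact_mod_cast this

end SubRep

/-! ### Splitting into stable summands. -/

section Decomposition

variable {I J : Type*} {A : I → J → Type*} {β : I ⊕ J → ℕ}
variable [Fintype I] [Fintype J] {σ : I ⊕ J → ℤ} {V : Rep A β}

theorem isInternal_of_finrank {n m : ℕ} (F : Fin m → Submodule ℝ (Fin n → ℝ)) (hF : ⨆ l, F l = ⊤)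
    (hd : ∑ l, Module.finrank ℝ (F l) = n) : DirectSum.IsInternal F := by
  have hsurj : Function.Surjective (DirectSum.coeLinearMap F) := by
    rw [← LinearMap.range_eq_top, DirectSum.range_coeLinearMap, hF]
  have hfr : Module.finrank ℝ (∀ l, F l) = Module.finrank ℝ (Fin n → ℝ) := by
    rw [Module.finrank_pi_fintype, hd, Module.finrank_fin_fun]
  let e := DirectSum.linearEquivFunOnFintype ℝ (Fin m) fun l => F l
  have hinj : Function.Injective (DirectSum.coeLinearMap F) := by
    have h := (LinearMap.injective_iff_surjective_of_finrank_eq_finrank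
      (f := DirectSum.coeLinearMap F ∘ₗ e.symm.toLinearMap) hfr).2
      (by simpa using hsurj.comp e.symm.surjective)
    intro x y hxy
    have := @h (e x) (e y) (by simpa using hxy)
    exact e.injective this
  exact ⟨hinj, hsurj⟩

/-- A semistable representation in which every subrepresentation of weight zero has a complement
is polystable. -/
theorem isPolystable_of_complemented (hσβ : ∑ x, σ x * (β x : ℤ) = 0)
    (hle : ∀ W : SubRep V, weight σ W ≤ 0)
    (hcompl : ∀ W : SubRep V, weight σ W = 0 →
      ∃ C : SubRep V, ∀ x, IsCompl (W.space x) (C.space x)) : IsPolystable V σ := by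
  let d : SubRep V → ℕ := fun W => ∑ x, Module.finrank ℝ (W.space x)
  have key : ∀ n, ∀ W : SubRep V, d W = n → weight σ W = 0 → ∃ (m : ℕ) (F : Fin m → SubRep V),
      (∀ l, IsStable σ (F l)) ∧ ∀ x, ⨆ l, (F l).space x = W.space x ∧
        ∑ l, Module.finrank ℝ ((F l).space x) = Module.finrank ℝ (W.space x) := by
    intro n
    induction n using Nat.strong_induction_on with
    | _ n ih =>
    intro W hWn hW0
    by_cases hz : ∀ x, W.space x = ⊥
    · exact ⟨0, fun l => l.elim0, fun l => l.elim0, fun x =>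
        ⟨by rw [hz x]; exact iSup_of_empty _, by rw [hz x]; simp⟩⟩
    push Not at hz
    -- A nonzero subrepresentation of weight zero of least total dimension is stable: all weights
    -- are nonpositive, and minimality excludes weight zero below it.
    obtain ⟨W', ⟨hle', hne', hw'⟩, hmin⟩ := (measure d).wf.has_min
      {W' : SubRep V | (∀ x, W'.space x ≤ W.space x) ∧ (∃ x, W'.space x ≠ ⊥) ∧ weight σ W' = 0}
      ⟨W, fun _ => le_rfl, hz, hW0⟩
    have hst : IsStable σ W' := by
      refine ⟨hne', hw', fun W'' hle'' hne'' hneq => (hle W'').lt_of_ne fun h0 => hneq ?_⟩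
      have hd : ¬ d W'' < d W' := hmin W'' ⟨fun x => (hle'' x).trans (hle' x), hne'', h0⟩
      have hfr : ∀ x, Module.finrank ℝ (W''.space x) ≤ Module.finrank ℝ (W'.space x) :=
        fun x => Submodule.finrank_mono (hle'' x)
      have heq := (Finset.sum_eq_sum_iff_of_le (s := Finset.univ) fun x _ => hfr x).1
        (le_antisymm (Finset.sum_le_sum fun x _ => hfr x) (not_lt.1 hd))
      ext1
      ext1 x
      exact Submodule.eq_of_le_of_finrank_eq (hle'' x) (heq x (Finset.mem_univ x))
    obtain ⟨C, hC⟩ := hcompl W' hw'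
    -- By the modular law, a complement in the whole space meets `W` in a complement of `W'` inside
    -- `W`.
    have hsup : ∀ x, W'.space x ⊔ (W.inter C).space x = W.space x := fun x => by
      have : (W.inter C).space x = C.space x ⊓ W.space x := inf_comm _ _
      rw [this, ← sup_inf_assoc_of_le _ (hle' x), (hC x).sup_eq_top, top_inf_eq]
    have hrk : ∀ x, Module.finrank ℝ (W'.space x) + Module.finrank ℝ ((W.inter C).space x)
        = Module.finrank ℝ (W.space x) := fun x => by
      have h := Submodule.finrank_sup_add_finrank_inf_eq (W'.space x) ((W.inter C).space x)
      have hbot : W'.space x ⊓ (W.inter C).space x = ⊥ :=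
        ((hC x).disjoint.mono_right inf_le_right).eq_bot
      rw [hbot, finrank_bot, add_zero, hsup] at h
      exact h.symm
    have hw2 : weight σ (W.inter C) = 0 := by
      have : weight σ W' + weight σ (W.inter C) = weight σ W := by
        simp only [weight, ← Finset.sum_add_distrib, ← mul_add]
        exact Finset.sum_congr rfl fun x _ => by rw [← hrk x]; push_cast; rfl
      rw [hw', hW0] at this
      simpa using this
    have hlt : d (W.inter C) < n := by
      rw [← hWn]
      refine Finset.sum_lt_sum (fun x _ => by rw [← hrk x]; exact Nat.le_add_left _ _) ?_
      obtain ⟨x, hx⟩ := hne'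
      refine ⟨x, Finset.mem_univ x, ?_⟩
      rw [← hrk x]
      have : Module.finrank ℝ (W'.space x) ≠ 0 := fun h => hx (Submodule.finrank_eq_zero.1 h)
      omega
    obtain ⟨m, F, hF, hFx⟩ := ih _ hlt (W.inter C) rfl hw2
    refine ⟨m + 1, Fin.cons W' F, fun l => ?_, fun x => ⟨?_, ?_⟩⟩
    · refine Fin.cases ?_ (fun l => ?_) l
      · exact hst
      · exact hF l
    · rw [← hsup x, ← (hFx x).1]
      refine le_antisymm (iSup_le fun l => ?_) (sup_le ?_ (iSup_le fun l => ?_))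
      · refine Fin.cases ?_ (fun l => ?_) l
        · exact le_sup_left
        · exact le_sup_of_le_right (le_iSup (fun l => (F l).space x) l)
      · exact le_iSup_of_le 0 le_rfl
      · exact le_iSup_of_le l.succ le_rfl
    · rw [Fin.sum_univ_succ, ← hrk x, ← (hFx x).2]
      rfl
  obtain ⟨m, F, hF, hFx⟩ := key _ (SubRep.univ V) rfl (weight_univ hσβ)
  refine ⟨m, F, hF, fun x => isInternal_of_finrank _ (hFx x).1 ?_⟩
  rw [(hFx x).2, finrank_univ_space]

end Decomposition

/-! ### Geometric data are polystable. -/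

section Semistable

/-- Orthonormalize a basis matrix `C` by its Gram matrix: if `Cᵀ C = L Lᵀ`, then `C L⁻ᵀ` has
orthonormal columns and the same range. -/
theorem exists_orthonormal_frame {n : ℕ} (W : Submodule ℝ (Fin n → ℝ)) :
    ∃ B : Matrix (Fin n) (Fin (Module.finrank ℝ W)) ℝ,
      Bᵀ * B = 1 ∧ LinearMap.range B.mulVecLin = W := by
  let b := Module.finBasis ℝ W
  let C : Matrix (Fin n) (Fin (Module.finrank ℝ W)) ℝ := Matrix.of fun t s => (b s : Fin n → ℝ) t
  have hCv : ∀ v, C *ᵥ v = ((∑ s, v s • b s : W) : Fin n → ℝ) := by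
    intro v
    ext t
    simp [C, mulVec, dotProduct, mul_comm]
  have hCinj : Function.Injective C.mulVec := by
    intro v w hvw
    rw [hCv, hCv] at hvw
    refine b.equivFun.symm.injective ?_
    rw [Module.Basis.equivFun_symm_apply, Module.Basis.equivFun_symm_apply]
    exact Subtype.ext hvw
  have hrC : LinearMap.range C.mulVecLin = W := by
    ext u
    constructor
    · rintro ⟨v, rfl⟩
      rw [mulVecLin_apply, hCv]
      exact Submodule.coe_mem _
    · intro hu
      refine ⟨b.equivFun ⟨u, hu⟩, ?_⟩
      rw [mulVecLin_apply, hCv, Module.Basis.sum_equivFun]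
  have hpd : (Cᵀ * C).PosDef := by
    simpa using PosDef.conjTranspose_mul_self C hCinj
  obtain ⟨L, hL⟩ := hpd.exists_eq_mul_transpose
  have h1 : L.valᵀ * (L⁻¹).valᵀ = 1 := by rw [← transpose_mul]; simp
  refine ⟨C * (L⁻¹).valᵀ, ?_, ?_⟩
  · calc _ = (L⁻¹).val * (Cᵀ * C) * (L⁻¹).valᵀ := by
          simp only [transpose_mul, transpose_transpose, Matrix.mul_assoc]
      _ = ((L⁻¹).val * L.val) * (L.valᵀ * (L⁻¹).valᵀ) := by
          rw [hL]; simp only [Matrix.mul_assoc]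
      _ = 1 := by rw [h1]; simp
  · refine Eq.trans (le_antisymm ?_ ?_) hrC
    · rintro _ ⟨v, rfl⟩
      exact ⟨(L⁻¹).valᵀ *ᵥ v, by
        rw [mulVecLin_apply, mulVecLin_apply, mulVec_mulVec]⟩
    · rintro _ ⟨v, rfl⟩
      refine ⟨L.valᵀ *ᵥ v, ?_⟩
      have h2 : (L⁻¹).valᵀ * L.valᵀ = 1 := by rw [← transpose_mul]; simp
      rw [mulVecLin_apply, mulVecLin_apply, mulVec_mulVec, Matrix.mul_assoc, h2, Matrix.mul_one]

theorem isCompl_range_ker_transpose {n d : ℕ} {B : Matrix (Fin n) (Fin d) ℝ} (hB : Bᵀ * B = 1) :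
    IsCompl (LinearMap.range B.mulVecLin) (LinearMap.ker Bᵀ.mulVecLin) := by
  constructor
  · rw [Submodule.disjoint_def]
    rintro _ ⟨v, rfl⟩ h
    rw [LinearMap.mem_ker, mulVecLin_apply, mulVecLin_apply, mulVec_mulVec, hB, one_mulVec] at h
    rw [h, map_zero]
  · rw [codisjoint_iff, eq_top_iff]
    rintro v -
    refine Submodule.mem_sup.2 ⟨B *ᵥ (Bᵀ *ᵥ v), ⟨_, rfl⟩, v - B *ᵥ (Bᵀ *ᵥ v), ?_, by abel⟩
    rw [LinearMap.mem_ker, mulVecLin_apply, mulVec_sub, mulVec_mulVec _ Bᵀ B, hB, one_mulVec,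
      sub_self]

variable {I J : Type*} {A : I → J → Type*} {β γ : I ⊕ J → ℕ}
variable [Fintype I] [Fintype J] [∀ i j, Fintype (A i j)] {σ : I ⊕ J → ℤ} {U : Rep A β}

theorem trace_transpose_mul_self_nonneg {m n : Type*} [Fintype m] [Fintype n] (M : Matrix m n ℝ) :
    0 ≤ (Mᵀ * M).trace := by
  simpa using (posSemidef_conjTranspose_mul_self M).trace_nonneg

/-- Pythagoras: the squared Frobenius norm of `B'ᵀ M` splits along the projection `B Bᵀ` and its
complement. Since `hM` says that `M` sends the range of `B` into that of `B'`, the first part is the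
squared norm of `M B`. -/
theorem trace_frame_add {n m d e : ℕ} {B : Matrix (Fin n) (Fin d) ℝ} {B' : Matrix (Fin m) (Fin e) ℝ}
    (hB : Bᵀ * B = 1) (hB' : B'ᵀ * B' = 1) {M : Matrix (Fin m) (Fin n) ℝ}
    (hM : B' * B'ᵀ * (M * B) = M * B) :
    ((M * B)ᵀ * (M * B)).trace +
      ((B'ᵀ * M * (1 - B * Bᵀ))ᵀ * (B'ᵀ * M * (1 - B * Bᵀ))).trace
      = ((B'ᵀ * M)ᵀ * (B'ᵀ * M)).trace := by
  set C := B'ᵀ * M with hC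
  have e1 : M * B = B' * (C * B) := by rw [← hM, hC]; simp only [Matrix.mul_assoc]
  have hP : (1 - B * Bᵀ) * (1 - B * Bᵀ)ᵀ = 1 - B * Bᵀ := by
    simp only [transpose_sub, transpose_one, transpose_mul, transpose_transpose, Matrix.sub_mul,
      Matrix.mul_sub, Matrix.one_mul, Matrix.mul_one]
    have : B * Bᵀ * (B * Bᵀ) = B * Bᵀ := by
      rw [Matrix.mul_assoc, ← Matrix.mul_assoc Bᵀ, hB, Matrix.one_mul]
    rw [this]; abel
  have t1 : ((M * B)ᵀ * (M * B)).trace = (Cᵀ * C * (B * Bᵀ)).trace := by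
    calc _ = (Bᵀ * Cᵀ * (B'ᵀ * B') * (C * B)).trace := by
          rw [e1]; simp only [transpose_mul, Matrix.mul_assoc]
      _ = (Bᵀ * (Cᵀ * C * B)).trace := by rw [hB', Matrix.mul_one]; simp only [Matrix.mul_assoc]
      _ = _ := by rw [trace_mul_comm]; simp only [Matrix.mul_assoc]
  have t2 : ((C * (1 - B * Bᵀ))ᵀ * (C * (1 - B * Bᵀ))).trace
      = (Cᵀ * C * (1 - B * Bᵀ)).trace := by
    conv_rhs => rw [← hP]
    rw [transpose_mul, Matrix.mul_assoc, trace_mul_comm]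
    simp only [Matrix.mul_assoc]
  rw [t1, t2, ← trace_add, ← Matrix.mul_add, add_sub_cancel, Matrix.mul_one]

/-- The weight of a subrepresentation of a geometric datum, in terms of orthonormal frames. -/
theorem IsGeometric.weight_eq (hσp : ∀ i, 0 < σ (Sum.inl i)) (hσn : ∀ j, σ (Sum.inr j) < 0)
    (hU : IsGeometric U σ) (W : SubRep U)
    (B : ∀ x, Matrix (Fin (β x)) (Fin (Module.finrank ℝ (W.space x))) ℝ)
    (hB : ∀ x, (B x)ᵀ * B x = 1) (hBW : ∀ x, LinearMap.range (B x).mulVecLin = W.space x) :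
    (weight σ W : ℝ) = -∑ i, ∑ j, ∑ a : A i j, (sigmaPlus σ i : ℝ) * sigmaMinus σ j *
      (((B (Sum.inr j))ᵀ * U i j a * (1 - B (Sum.inl i) * (B (Sum.inl i))ᵀ))ᵀ *
        ((B (Sum.inr j))ᵀ * U i j a * (1 - B (Sum.inl i) * (B (Sum.inl i))ᵀ))).trace := by
  have hinv : ∀ i j (a : A i j), B (Sum.inr j) * (B (Sum.inr j))ᵀ * (U i j a * B (Sum.inl i))
      = U i j a * B (Sum.inl i) := by
    intro i j a
    refine ext_of_mulVec_single fun s => ?_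
    have hmem : (U i j a * B (Sum.inl i)) *ᵥ Pi.single s 1 ∈ W.space (Sum.inr j) := by
      rw [← mulVec_mulVec]
      exact W.map_mem i j a _ ((hBW _).le ⟨_, rfl⟩)
    obtain ⟨v, hv⟩ := (hBW _).ge hmem
    rw [mulVecLin_apply] at hv
    rw [← mulVec_mulVec, ← hv, mulVec_mulVec, Matrix.mul_assoc, hB, Matrix.mul_one]
  -- Compressing the geometric identities to the subspaces and taking traces expresses their
  -- dimensions by squared norms.
  have h1 : ∀ i, (Module.finrank ℝ (W.space (Sum.inl i)) : ℝ) = ∑ j, ∑ a : A i j,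
      (sigmaMinus σ j : ℝ) * ((U i j a * B (Sum.inl i))ᵀ * (U i j a * B (Sum.inl i))).trace := by
    intro i
    have h := congrArg (fun M => ((B (Sum.inl i))ᵀ * M * B (Sum.inl i)).trace) (hU.1 i)
    simp only [Matrix.mul_one, hB, trace_one, Fintype.card_fin] at h
    rw [← h]
    simp only [Matrix.mul_sum, Matrix.sum_mul, Matrix.mul_smul, Matrix.smul_mul, trace_sum,
      trace_smul, smul_eq_mul, transpose_mul, Matrix.mul_assoc, Finset.mul_sum]
  have h2 : ∀ j, (Module.finrank ℝ (W.space (Sum.inr j)) : ℝ) = ∑ i, ∑ a : A i j,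
      (sigmaPlus σ i : ℝ) *
        (((B (Sum.inr j))ᵀ * U i j a)ᵀ * ((B (Sum.inr j))ᵀ * U i j a)).trace := by
    intro j
    have h := congrArg (fun M => ((B (Sum.inr j))ᵀ * M * B (Sum.inr j)).trace) (hU.2 j)
    simp only [Matrix.mul_one, hB, trace_one, Fintype.card_fin] at h
    rw [← h]
    simp only [Matrix.mul_sum, Matrix.sum_mul, Matrix.mul_smul, Matrix.smul_mul, trace_sum,
      trace_smul, smul_eq_mul, Finset.mul_sum]
    refine Finset.sum_congr rfl fun i _ => Finset.sum_congr rfl fun a _ => ?_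
    rw [trace_mul_comm ((B (Sum.inr j))ᵀ * U i j a)ᵀ]
    simp only [transpose_mul, transpose_transpose, Matrix.mul_assoc]
  have e1 : ∀ i, ((σ (Sum.inl i) : ℤ) : ℝ) = sigmaPlus σ i := fun i => by
    exact_mod_cast (Int.toNat_of_nonneg (hσp i).le).symm
  have e2 : ∀ j, ((σ (Sum.inr j) : ℤ) : ℝ) = -sigmaMinus σ j := fun j => by
    have : (sigmaMinus σ j : ℤ) = -σ (Sum.inr j) := Int.toNat_of_nonneg (by linarith [hσn j])
    have h' : ((sigmaMinus σ j : ℤ) : ℝ) = ((-σ (Sum.inr j) : ℤ) : ℝ) := by rw [this]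
    push_cast at h'
    linarith
  rw [weight, Fintype.sum_sum_type]
  push_cast
  simp only [e1, e2, h1, h2, Finset.mul_sum]
  rw [Finset.sum_comm (s := (Finset.univ : Finset J)), ← Finset.sum_add_distrib,
    ← Finset.sum_neg_distrib]
  refine Finset.sum_congr rfl fun i _ => ?_
  rw [← Finset.sum_add_distrib, ← Finset.sum_neg_distrib]
  refine Finset.sum_congr rfl fun j _ => ?_
  rw [← Finset.sum_add_distrib, ← Finset.sum_neg_distrib]
  refine Finset.sum_congr rfl fun a _ => ?_
  rw [← trace_frame_add (hB _) (hB _) (hinv i j a)]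
  ring

theorem IsGeometric.weight_nonpos (hσp : ∀ i, 0 < σ (Sum.inl i)) (hσn : ∀ j, σ (Sum.inr j) < 0)
    (hU : IsGeometric U σ) (W : SubRep U) : weight σ W ≤ 0 := by
  choose B hB hBW using fun x => exists_orthonormal_frame (W.space x)
  have h := hU.weight_eq hσp hσn W B hB hBW
  have : (weight σ W : ℝ) ≤ 0 := by
    rw [h, neg_nonpos]
    exact Finset.sum_nonneg fun i _ => Finset.sum_nonneg fun j _ => Finset.sum_nonneg fun a _ =>
      mul_nonneg (by positivity) (trace_transpose_mul_self_nonneg _)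
  exact_mod_cast this

theorem sigmaMinus_pos (hσ : ∀ j, σ (Sum.inr j) < 0) (j : J) : 0 < sigmaMinus σ j := by
  have := hσ j
  simp only [sigmaMinus]; omega

/-- Weight zero forces every square in the weight formula to vanish, and then each arrow carries the
orthogonal complement at its tail into the one at its head. -/
theorem IsGeometric.exists_isCompl (hσp : ∀ i, 0 < σ (Sum.inl i)) (hσn : ∀ j, σ (Sum.inr j) < 0)
    (hU : IsGeometric U σ) (W : SubRep U) (hW : weight σ W = 0) :
    ∃ C : SubRep U, ∀ x, IsCompl (W.space x) (C.space x) := by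
  choose B hB hBW using fun x => exists_orthonormal_frame (W.space x)
  have h := hU.weight_eq hσp hσn W B hB hBW
  have hnn : ∀ i j (a : A i j), 0 ≤ (sigmaPlus σ i : ℝ) * sigmaMinus σ j *
      (((B (Sum.inr j))ᵀ * U i j a * (1 - B (Sum.inl i) * (B (Sum.inl i))ᵀ))ᵀ *
        ((B (Sum.inr j))ᵀ * U i j a * (1 - B (Sum.inl i) * (B (Sum.inl i))ᵀ))).trace :=
    fun i j a => mul_nonneg (by positivity) (trace_transpose_mul_self_nonneg _)
  rw [hW, Int.cast_zero, eq_comm, neg_eq_zero, Finset.sum_eq_zero_iff_of_nonneg fun i _ =>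
    Finset.sum_nonneg fun j _ => Finset.sum_nonneg fun a _ => hnn i j a] at h
  have hzero : ∀ i j (a : A i j),
      (B (Sum.inr j))ᵀ * U i j a * (1 - B (Sum.inl i) * (B (Sum.inl i))ᵀ) = 0 := by
    intro i j a
    have h1 := h i (Finset.mem_univ i)
    rw [Finset.sum_eq_zero_iff_of_nonneg fun j _ => Finset.sum_nonneg fun a _ => hnn i j a] at h1
    have h2 := h1 j (Finset.mem_univ j)
    rw [Finset.sum_eq_zero_iff_of_nonneg fun a _ => hnn i j a] at h2
    have h3 := h2 a (Finset.mem_univ a)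
    have p1 : (sigmaPlus σ i : ℝ) ≠ 0 := by
      have := hσp i
      simp only [sigmaPlus, ne_eq, Nat.cast_eq_zero]; omega
    have p2 : (sigmaMinus σ j : ℝ) ≠ 0 := by exact_mod_cast (sigmaMinus_pos hσn j).ne'
    have h4 := (mul_eq_zero.1 h3).resolve_left (mul_ne_zero p1 p2)
    rw [← conjTranspose_eq_transpose_of_trivial, trace_conjTranspose_mul_self_eq_zero_iff] at h4
    exact h4
  refine ⟨⟨fun x => LinearMap.ker (B x)ᵀ.mulVecLin, fun i j a u hu => ?_⟩, fun x => ?_⟩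
  · rw [LinearMap.mem_ker, mulVecLin_apply] at hu ⊢
    have := congrArg (fun M => M *ᵥ u) (hzero i j a)
    simp only [zero_mulVec] at this
    rw [← mulVec_mulVec, sub_mulVec, one_mulVec, ← mulVec_mulVec (v := u), hu, mulVec_zero,
      sub_zero, ← mulVec_mulVec] at this
    exact this
  · have h := hBW x
    refine h ▸ ?_
    exact isCompl_range_ker_transpose (hB x)

theorem isPolystable_of_mem_geometrizers (hσp : ∀ i, 0 < σ (Sum.inl i))
    (hσn : ∀ j, σ (Sum.inr j) < 0) (hσβ : ∑ x, σ x * (β x : ℤ) = 0) {V : Rep A β} {g : GLβ β}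
    (hg : g ∈ geometrizers V σ) : IsPolystable V σ := by
  have hh : ∀ i j (a : A i j), (g (Sum.inr j)).val * V i j a
      = act g V i j a * (g (Sum.inl i)).val := by
    intro i j a
    rw [act, Matrix.mul_assoc]
    simp
  have hinj : ∀ x, Function.Injective (g x).val.mulVecLin := fun x =>
    mulVec_injective_of_isUnit (g x).isUnit
  refine isPolystable_of_complemented hσβ (fun W => ?_) fun W hW => ?_
  · rw [← weight_map (fun x => (g x).val) hh hinj]
    exact hg.weight_nonpos hσp hσn _
  · obtain ⟨C, hC⟩ := hg.exists_isCompl hσp hσn (W.map (fun x => (g x).val) hh)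
      (by rw [weight_map _ hh hinj, hW])
    refine ⟨C.comap (fun x => (g x).val) hh, fun x => ⟨?_, ?_⟩⟩
    · rw [Submodule.disjoint_def]
      intro u hu hu'
      have := Submodule.disjoint_def.1 (hC x).disjoint ((g x).val.mulVecLin u) ⟨u, hu, rfl⟩ hu'
      exact hinj x (by rw [this, map_zero])
    · rw [codisjoint_iff, eq_top_iff]
      rintro v -
      have hv : (g x).val.mulVecLin v ∈ (W.map (fun x => (g x).val) hh).space x ⊔ C.space x := by
        rw [(hC x).sup_eq_top]; exact Submodule.mem_top
      obtain ⟨_, ⟨w, hw, rfl⟩, c, hc, hwc⟩ := Submodule.mem_sup.1 hv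
      refine Submodule.mem_sup.2 ⟨w, hw, v - w, ?_, by abel⟩
      change (g x).val.mulVecLin (v - w) ∈ C.space x
      rw [map_sub, ← hwc, add_sub_cancel_left]
      exact hc

end Semistable

/-! ### Existence of a balanced tuple by maximization. -/

section Existence

variable {I J : Type*} {A : I → J → Type*} {β : I ⊕ J → ℕ}

theorem blockLift_smul {κ : Type*} [Fintype κ] [DecidableEq κ] {c b : κ → ℕ} (t : ℝ)
    (S : ∀ k, Matrix (Fin (b k)) (Fin (b k)) ℝ) :
    blockLift c (fun k => t • S k) = t • blockLift c S := by
  simp only [← sum_blockEmb_mul_mul_transpose, Finset.smul_sum, Matrix.mul_smul, Matrix.smul_mul]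

theorem isCompact_entries {X : Type*} (m n : X → ℕ) :
    IsCompact {L : ∀ x, Matrix (Fin (m x)) (Fin (n x)) ℝ |
      ∀ x s t, L x s t ∈ Set.Icc (-1 : ℝ) 1} := by
  have h := isCompact_univ_pi fun x : X => isCompact_univ_pi fun _ : Fin (m x) =>
    isCompact_univ_pi fun _ : Fin (n x) => isCompact_Icc (a := (-1 : ℝ)) (b := 1)
  have h' : IsCompact {L : ∀ x, Fin (m x) → Fin (n x) → ℝ |
      ∀ x s t, L x s t ∈ Set.Icc (-1 : ℝ) 1} := by
    convert h using 1
    ext L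
    simp only [Set.mem_ofPred_eq, Set.mem_pi, Set.mem_univ, true_imp_iff]
  exact h'

theorem isCompact_rep_entries (A : I → J → Type*) (β : I ⊕ J → ℕ) :
    IsCompact {U : Rep A β | ∀ i j a s t, U i j a s t ∈ Set.Icc (-1 : ℝ) 1} := by
  have h := isCompact_univ_pi fun i : I => isCompact_univ_pi fun j : J =>
    isCompact_univ_pi fun _ : A i j => isCompact_univ_pi fun _ : Fin (β (Sum.inr j)) =>
    isCompact_univ_pi fun _ : Fin (β (Sum.inl i)) => isCompact_Icc (a := (-1 : ℝ)) (b := 1)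
  have h' : IsCompact {U : ∀ i j, A i j → Fin (β (Sum.inr j)) → Fin (β (Sum.inl i)) → ℝ |
      ∀ i j a s t, U i j a s t ∈ Set.Icc (-1 : ℝ) 1} := by
    convert h using 1
    ext L
    simp only [Set.mem_ofPred_eq, Set.mem_pi, Set.mem_univ, true_imp_iff]
  exact h'

/-- The sum of the squares of all entries of a tuple of square matrices. -/
def sumSq {X : Type*} [Fintype X] {m : X → ℕ} (L : ∀ x, Matrix (Fin (m x)) (Fin (m x)) ℝ) : ℝ :=
  ∑ x, ∑ s, ∑ t, L x s t ^ 2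

theorem sumSq_smul {X : Type*} [Fintype X] {m : X → ℕ} (c : ℝ)
    (L : ∀ x, Matrix (Fin (m x)) (Fin (m x)) ℝ) : sumSq (fun x => c • L x) = c ^ 2 * sumSq L := by
  simp [sumSq, mul_pow, Finset.mul_sum]

theorem continuous_sumSq {X : Type*} [Fintype X] {m : X → ℕ} :
    Continuous (sumSq : (∀ x, Matrix (Fin (m x)) (Fin (m x)) ℝ) → ℝ) := by
  unfold sumSq
  fun_prop

theorem mem_Icc_of_sumSq_eq_one {X : Type*} [Fintype X] {m : X → ℕ}
    {L : ∀ x, Matrix (Fin (m x)) (Fin (m x)) ℝ} (h : sumSq L = 1) (x : X) (s t : Fin (m x)) :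
    L x s t ∈ Set.Icc (-1 : ℝ) 1 := by
  have h1 : L x s t ^ 2 ≤ 1 := by
    rw [← h]
    calc L x s t ^ 2 ≤ ∑ t, L x s t ^ 2 :=
          Finset.single_le_sum (f := fun t => L x s t ^ 2) (fun _ _ => sq_nonneg _)
            (Finset.mem_univ t)
      _ ≤ ∑ s, ∑ t, L x s t ^ 2 :=
          Finset.single_le_sum (f := fun s => ∑ t, L x s t ^ 2)
            (fun _ _ => Finset.sum_nonneg fun _ _ => sq_nonneg _) (Finset.mem_univ s)
      _ ≤ sumSq L :=
          Finset.single_le_sum (f := fun x => ∑ s, ∑ t, L x s t ^ 2)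
            (fun _ _ => Finset.sum_nonneg fun _ _ => Finset.sum_nonneg fun _ _ => sq_nonneg _)
            (Finset.mem_univ x)
  exact abs_le.1 ((sq_le_one_iff_abs_le_one _).1 h1)

theorem sumSq_pos {X : Type*} [Fintype X] {m : X → ℕ}
    {L : ∀ x, Matrix (Fin (m x)) (Fin (m x)) ℝ} {x : X} (h : L x ≠ 0) : 0 < sumSq L := by
  obtain ⟨s, t, hst⟩ : ∃ s t, L x s t ≠ 0 := by
    by_contra! h0
    exact h (by ext s t; exact h0 s t)
  refine Finset.sum_pos' (fun _ _ => Finset.sum_nonneg fun _ _ => Finset.sum_nonneg fun _ _ =>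
    sq_nonneg _) ⟨x, Finset.mem_univ x, ?_⟩
  refine Finset.sum_pos' (fun _ _ => Finset.sum_nonneg fun _ _ => sq_nonneg _)
    ⟨s, Finset.mem_univ s, ?_⟩
  exact Finset.sum_pos' (fun _ _ => sq_nonneg _) ⟨t, Finset.mem_univ t, by positivity⟩

theorem exists_sumSq_smul_eq_one {X : Type*} [Fintype X] {m : X → ℕ}
    {L : ∀ x, Matrix (Fin (m x)) (Fin (m x)) ℝ} {x : X} (h : L x ≠ 0) :
    ∃ c : ℝ, 0 < c ∧ sumSq (fun x => c • L x) = 1 := by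
  have hp := sumSq_pos h
  refine ⟨(√(sumSq L))⁻¹, inv_pos.2 (Real.sqrt_pos.2 hp), ?_⟩
  rw [sumSq_smul, inv_pow, Real.sq_sqrt hp.le, inv_mul_cancel₀ hp.ne']

variable [Fintype I] [Fintype J] [∀ i j, Fintype (A i j)] {σ : I ⊕ J → ℤ} {V : Rep A β}

theorem pushForm_smul (c : ℝ)
    (S : ∀ i : I, Matrix (Fin (β (Sum.inl i))) (Fin (β (Sum.inl i))) ℝ) (j : J) :
    pushForm V σ (fun i => c • S i) j = c • pushForm V σ S j := by
  simp only [pushForm, Matrix.mul_smul, Matrix.smul_mul, Finset.smul_sum, smul_smul, mul_comm c]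

theorem exists_source_pos (hσn : ∀ j, σ (Sum.inr j) < 0) (hσβ : ∑ x, σ x * (β x : ℤ) = 0)
    (hx : ∃ x, 0 < β x) : ∃ i : I, 0 < β (Sum.inl i) := by
  by_contra! h
  have h0 : ∀ i : I, β (Sum.inl i) = 0 := fun i => Nat.le_zero.1 (h i)
  obtain ⟨x | j, hx⟩ := hx
  · exact absurd (h x) (by omega)
  rw [Fintype.sum_sum_type] at hσβ
  simp only [h0, Nat.cast_zero, mul_zero, Finset.sum_const_zero, zero_add] at hσβ
  have : ∑ j : J, σ (Sum.inr j) * (β (Sum.inr j) : ℤ) < 0 := by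
    refine Finset.sum_neg' (fun j _ => ?_) ⟨j, Finset.mem_univ j, ?_⟩
    · exact mul_nonpos_of_nonpos_of_nonneg (hσn j).le (by positivity)
    · exact mul_neg_of_neg_of_pos (hσn j) (by exact_mod_cast hx)
  omega

theorem exists_sink_pos (hσp : ∀ i, 0 < σ (Sum.inl i)) (hσβ : ∑ x, σ x * (β x : ℤ) = 0)
    (hx : ∃ x, 0 < β x) : ∃ j : J, 0 < β (Sum.inr j) := by
  by_contra! h
  have h0 : ∀ j : J, β (Sum.inr j) = 0 := fun i => Nat.le_zero.1 (h i)
  obtain ⟨i | x, hx⟩ := hx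
  swap
  · exact absurd (h x) (by omega)
  rw [Fintype.sum_sum_type] at hσβ
  simp only [h0, Nat.cast_zero, mul_zero, Finset.sum_const_zero, add_zero] at hσβ
  have : 0 < ∑ i : I, σ (Sum.inl i) * (β (Sum.inl i) : ℤ) := by
    refine Finset.sum_pos' (fun i _ => ?_) ⟨i, Finset.mem_univ i, ?_⟩
    · exact mul_nonneg (hσp i).le (by positivity)
    · exact mul_pos (hσp i) (by exact_mod_cast hx)
  omega

/-- Here `L` may be singular: absorb it into the representation, replacing `V(a)` by `V(a) L i`, and
push forward the identity. -/
theorem pushForm_mul_transpose_posDef (hσp : ∀ i, 0 < σ (Sum.inl i))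
    {L : ∀ i : I, Matrix (Fin (β (Sum.inl i))) (Fin (β (Sum.inl i))) ℝ} {j : J}
    (h : ∀ u : Fin (β (Sum.inr j)) → ℝ, u ≠ 0 →
      ∃ i, ∃ a : A i j, (L i)ᵀ *ᵥ ((V i j a)ᵀ *ᵥ u) ≠ 0) :
    (pushForm V σ (fun i => L i * (L i)ᵀ) j).PosDef := by
  have := pushForm_posDef (V := fun i j a => V i j a * L i) hσp (S := fun i => 1)
    (fun i => PosDef.one) (j := j) fun u hu => by
      obtain ⟨i, a, hia⟩ := h u hu
      exact ⟨i, a, by rwa [transpose_mul, ← mulVec_mulVec]⟩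
  simpa only [pushForm, Matrix.mul_one, transpose_mul, Matrix.mul_assoc] using this

variable [DecidableEq I] [DecidableEq J]

/-- If the forms pushed forward along `V` and pulled back along `V` are always nondegenerate, then
a balanced tuple exists: it maximizes the inverse of `capAt`. -/
theorem exists_isBalanced_of_positive (hσp : ∀ i, 0 < σ (Sum.inl i))
    (hσn : ∀ j, σ (Sum.inr j) < 0) (hσβ : ∑ x, σ x * (β x : ℤ) = 0) (hx : ∃ x, 0 < β x)
    (hpush : ∀ L : (∀ i : I, Matrix (Fin (β (Sum.inl i))) (Fin (β (Sum.inl i))) ℝ), ∀ i, L i ≠ 0 →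
      ∀ j, ∀ u : Fin (β (Sum.inr j)) → ℝ, u ≠ 0 →
        ∃ i, ∃ a : A i j, (L i)ᵀ *ᵥ ((V i j a)ᵀ *ᵥ u) ≠ 0)
    (hpull : ∀ i, ∀ u : Fin (β (Sum.inl i)) → ℝ, u ≠ 0 → ∃ j, ∃ a : A i j, V i j a *ᵥ u ≠ 0) :
    ∃ S, IsBalanced V σ S := by
  obtain ⟨i₀, hi₀⟩ := exists_source_pos hσn hσβ hx
  have hc := card_rowIdx_eq hσp hσn hσβ
  have hone : (1 : Matrix (Fin (β (Sum.inl i₀))) (Fin (β (Sum.inl i₀))) ℝ) ≠ 0 := by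
    intro h
    have := congrFun (congrFun h ⟨0, hi₀⟩) ⟨0, hi₀⟩
    simp at this
  let T := ∀ i : I, Matrix (Fin (β (Sum.inl i))) (Fin (β (Sum.inl i))) ℝ
  let sq : T → T := fun L i => L i * (L i)ᵀ
  -- Writing `S = L Lᵀ` with `L` on the unit sphere makes the domain compact. Singular `L` are
  -- admitted, since `hpush` keeps the denominator positive; the numerator vanishes there, so they
  -- are not maximizers.
  let φ : T → ℝ := fun L => (blockLift (sigmaPlus σ) (sq L)).det /
    (blockLift (sigmaMinus σ) (pushForm V σ (sq L))).det
  have hpd : ∀ L : T, sumSq L = 1 → ∀ j, (pushForm V σ (sq L) j).PosDef := by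
    intro L hL j
    obtain ⟨i, hi⟩ : ∃ i, L i ≠ 0 := by
      by_contra! h0
      simp [sumSq, h0] at hL
    exact pushForm_mul_transpose_posDef hσp (hpush L i hi j)
  have hcompact : IsCompact {L : T | sumSq L = 1} :=
    (isCompact_entries _ _).of_isClosed_subset
      (isClosed_eq continuous_sumSq continuous_const) fun L hL x s t =>
        mem_Icc_of_sumSq_eq_one hL x s t
  have hcont : ContinuousOn φ {L : T | sumSq L = 1} := by
    refine ContinuousOn.div (Continuous.continuousOn ?_) (Continuous.continuousOn ?_) ?_
    · simp only [det_blockLift, sq]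
      fun_prop
    · simp only [det_blockLift, sq, pushForm]
      fun_prop
    · intro L hL
      exact (blockLift_posDef (hpd L hL)).det_pos.ne'
  obtain ⟨c₁, hc₁, hc₁'⟩ := exists_sumSq_smul_eq_one (X := I)
    (L := fun i => (1 : Matrix (Fin (β (Sum.inl i))) (Fin (β (Sum.inl i))) ℝ)) hone
  obtain ⟨L, hL, hmax⟩ := hcompact.exists_isMaxOn ⟨_, hc₁'⟩ hcont
  -- Numerator and denominator have equal degree, so a maximum on the sphere is global.
  have hscale : ∀ (L : T) (c : ℝ), c ≠ 0 → φ (fun i => c • L i) = φ L := by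
    intro L c hc0
    have h1 : sq (fun i => c • L i) = fun i => (c * c) • sq L i := by
      ext1 i
      simp only [sq, transpose_smul, Matrix.smul_mul, Matrix.mul_smul, smul_smul]
    have h2 : pushForm V σ (fun i => (c * c) • sq L i)
        = fun j => (c * c) • pushForm V σ (sq L) j := funext fun j => pushForm_smul _ _ j
    simp only [φ, h1, h2, blockLift_smul, det_smul, hc]
    exact mul_div_mul_left _ _ (pow_ne_zero _ (mul_ne_zero hc0 hc0))
  have hglobal : ∀ S' : T, (∀ i, (S' i).PosDef) →
      (blockLift (sigmaPlus σ) S').det / (blockLift (sigmaMinus σ) (pushForm V σ S')).det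
        ≤ φ L := by
    intro S' hS'
    choose L' hL' using fun i => (hS' i).exists_eq_mul_transpose
    have hne : (L' i₀).val ≠ 0 := by
      intro h0
      have h := (hS' i₀).det_pos
      have : Nonempty (Fin (β (Sum.inl i₀))) := ⟨⟨0, hi₀⟩⟩
      rw [hL', h0, Matrix.zero_mul, det_zero] at h
      exact lt_irrefl _ h
    obtain ⟨c, hc0, hcL⟩ := exists_sumSq_smul_eq_one (X := I) (L := fun i => (L' i).val) hne
    have := hmax hcL
    rw [Set.mem_ofPred_eq, hscale _ c hc0.ne'] at this
    have e : S' = sq (fun i => (L' i).val) := funext hL'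
    rw [e]
    exact this
  have hQ := blockLift_posDef (c := sigmaMinus σ) (hpd L hL)
  have hφ : 0 < φ L := by
    refine lt_of_lt_of_le ?_ (hglobal (fun i => 1) fun i => PosDef.one)
    refine div_pos (blockLift_posDef fun i => PosDef.one).det_pos
      (blockLift_posDef fun j => ?_).det_pos
    refine pushForm_posDef hσp (fun i => PosDef.one) fun u hu => ?_
    obtain ⟨i, a, ha⟩ := hpush (fun i => 1) i₀ hone j u hu
    exact ⟨i, a, by simpa using ha⟩
  have hS : ∀ i, (sq L i).PosDef := by
    intro i
    refine PosSemidef.posDef_of_det_ne_zero ?_ ?_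
    · simpa [sq] using posSemidef_self_mul_conjTranspose (L i)
    · intro h0
      have : (blockLift (sigmaPlus σ) (sq L)).det = 0 := by
        rw [det_blockLift]
        exact Finset.prod_eq_zero (Finset.mem_univ i)
          (by rw [h0, zero_pow (sigmaPlus_pos hσp i).ne'])
      simp [φ, this] at hφ
  have hSl := blockLift_posDef (c := sigmaPlus σ) hS
  refine ⟨sq L, isBalanced_of_one_le_det hσp hc hS (hpd L hL) ?_⟩
  set Q := blockLift (sigmaMinus σ) (pushForm V σ (sq L)) with hQdef
  -- One step of alternating scaling: compare the maximizer with the competitor `P⁻¹`. By AM-GM its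
  -- push-forward has determinant at most `det Q`, so maximality gives `1 ≤ det P * det S` on the
  -- block level.
  let P := pullForm V σ fun j => (pushForm V σ (sq L) j)⁻¹
  have hP : ∀ i, (P i).PosDef := fun i =>
    pullForm_posDef hσn (fun j => (hpd L hL j).inv) (hpull i)
  have hPl := blockLift_posDef (c := sigmaPlus σ) hP
  have hbl : blOperator V σ Q⁻¹ = blockLift (sigmaPlus σ) P := by
    rw [hQdef, blockLift_inv (hpd L hL), blOperator_blockLift]
  have hP' : ∀ i, ((P i)⁻¹).PosDef := fun i => (hP i).inv
  have hpush' : ∀ j, (pushForm V σ (fun i => (P i)⁻¹) j).PosDef := by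
    intro j
    refine pushForm_posDef hσp hP' fun u hu => ?_
    obtain ⟨i, a, ha⟩ := hpush (fun i => 1) i₀ hone j u hu
    exact ⟨i, a, by simpa using ha⟩
  have hQ' := blockLift_posDef (c := sigmaMinus σ) hpush'
  have hle := hglobal (fun i => (P i)⁻¹) hP'
  have htr := hQ.inv.posSemidef.det_mul_le_exp hQ'
  rw [← sum_krausFamily_mul_blockLift, ← trace_blOperator_mul, hbl, ← blockLift_inv hP,
    mul_nonsing_inv _ ((isUnit_iff_isUnit_det _).1 hPl.isUnit), trace_one, hc, sub_self,
    Real.exp_zero, blockLift_inv hP, sum_krausFamily_mul_blockLift, det_mul, det_nonsing_inv,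
    Ring.inverse_eq_inv, inv_mul_le_iff₀ hQ.det_pos, mul_one] at htr
  rw [← blockLift_inv hP, det_nonsing_inv, Ring.inverse_eq_inv, div_le_div_iff₀ hQ'.det_pos
    hQ.det_pos, inv_mul_le_iff₀ hPl.det_pos] at hle
  rw [hbl, det_mul]
  have h3 : Q.det ≤ (blockLift (sigmaPlus σ) P).det * (blockLift (sigmaPlus σ) (sq L)).det * Q.det
      := by
    refine hle.trans ?_
    rw [mul_assoc]
    exact mul_le_mul_of_nonneg_left (mul_le_mul_of_nonneg_left htr hSl.det_pos.le) hPl.det_pos.le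
  exact le_of_mul_le_mul_right (by rwa [one_mul]) hQ.det_pos

end Existence

/-! ### Stable representations, by perturbation and a limit. -/

section Stable

variable {I J : Type*} {A : I → J → Type*} {β : I ⊕ J → ℕ}

/-- The arrows of the quiver together with one new arrow for each matrix unit. -/
abbrev ExtArrow (A : I → J → Type*) (β : I ⊕ J → ℕ) (i : I) (j : J) :=
  A i j ⊕ (Fin (β (Sum.inr j)) × Fin (β (Sum.inl i)))

/-- `V` extended by `ε` times every matrix unit. -/
def perturb (V : Rep A β) (ε : ℝ) : Rep (ExtArrow A β) β := fun i j a =>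
  Sum.elim (fun a => V i j a) (fun p => Matrix.single p.1 p.2 ε) a

variable [Fintype I] [Fintype J] [∀ i j, Fintype (A i j)] {σ : I ⊕ J → ℤ} {V : Rep A β}

/-- The diagonal entries of the first geometric identity write 1 as a sum of squares with
coefficients at least 1. This boundedness supplies the compactness for the limit. -/
theorem IsGeometric.entry_mem_Icc (hσn : ∀ j, σ (Sum.inr j) < 0) (hV : IsGeometric V σ) (i : I)
    (j : J) (a : A i j) (s : Fin (β (Sum.inr j))) (t : Fin (β (Sum.inl i))) :
    V i j a s t ∈ Set.Icc (-1 : ℝ) 1 := by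
  have h := congrFun (congrFun (hV.1 i) t) t
  simp only [Matrix.sum_apply, Matrix.smul_apply, Matrix.mul_apply, transpose_apply, one_apply_eq,
    smul_eq_mul] at h
  have h1 : V i j a s t ^ 2 ≤ 1 := by
    rw [← h]
    have hσ : (1 : ℝ) ≤ sigmaMinus σ j := by exact_mod_cast sigmaMinus_pos hσn j
    calc V i j a s t ^ 2 = V i j a s t * V i j a s t := sq _
      _ ≤ ∑ s, V i j a s t * V i j a s t :=
          Finset.single_le_sum (f := fun s => V i j a s t * V i j a s t)
            (fun _ _ => mul_self_nonneg _) (Finset.mem_univ s)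
      _ ≤ ∑ a, ∑ s, V i j a s t * V i j a s t :=
          Finset.single_le_sum (f := fun a => ∑ s, V i j a s t * V i j a s t)
            (fun _ _ => Finset.sum_nonneg fun _ _ => mul_self_nonneg _) (Finset.mem_univ a)
      _ ≤ sigmaMinus σ j * ∑ a, ∑ s, V i j a s t * V i j a s t :=
          le_mul_of_one_le_left (Finset.sum_nonneg fun _ _ => Finset.sum_nonneg fun _ _ =>
            mul_self_nonneg _) hσ
      _ ≤ _ := Finset.single_le_sum
            (f := fun j => (sigmaMinus σ j : ℝ) * ∑ a, ∑ s, V i j a s t * V i j a s t)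
            (fun _ _ => mul_nonneg (Nat.cast_nonneg _) (Finset.sum_nonneg fun _ _ =>
              Finset.sum_nonneg fun _ _ => mul_self_nonneg _)) (Finset.mem_univ j)
  exact abs_le.1 ((sq_le_one_iff_abs_le_one _).1 h1)

variable [DecidableEq I] [DecidableEq J]

/-- The matrix unit at `(s, t)` pulls a vector `u` with `u s ≠ 0` back to a nonzero multiple of the
basis vector `t`. Choosing `t` to be a nonzero row of `L i` gives the first nondegeneracy condition;
the second is similar. -/
theorem exists_isBalanced_perturb (hσp : ∀ i, 0 < σ (Sum.inl i))
    (hσn : ∀ j, σ (Sum.inr j) < 0) (hσβ : ∑ x, σ x * (β x : ℤ) = 0) (hx : ∃ x, 0 < β x)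
    {ε : ℝ} (hε : 0 < ε) : ∃ S, IsBalanced (perturb V ε) σ S := by
  refine exists_isBalanced_of_positive hσp hσn hσβ hx ?_ ?_
  · intro L i hL j u hu
    obtain ⟨s, hs⟩ := Function.ne_iff.1 hu
    obtain ⟨t, r, htr⟩ : ∃ t r, L i t r ≠ 0 := by
      by_contra! h0
      exact hL (by ext t r; exact h0 t r)
    refine ⟨i, Sum.inr (s, t), fun h => ?_⟩
    have e : (perturb V ε i j (Sum.inr (s, t)))ᵀ *ᵥ u = Pi.single t (ε * u s) := by
      simp [perturb, single_mulVec, Pi.single]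
    rw [e] at h
    have := congrFun h r
    simp only [mulVec_single, Pi.smul_apply, col_apply, transpose_apply, Pi.zero_apply,
      MulOpposite.smul_eq_mul_unop, MulOpposite.unop_op] at this
    exact mul_ne_zero htr (mul_ne_zero hε.ne' hs) this
  · intro i u hu
    obtain ⟨t, ht⟩ := Function.ne_iff.1 hu
    obtain ⟨j, hj⟩ := exists_sink_pos hσp hσβ hx
    refine ⟨j, Sum.inr (⟨0, hj⟩, t), fun h => ?_⟩
    have := congrFun h ⟨0, hj⟩
    simp only [perturb, Sum.elim_inr, single_mulVec, Pi.zero_apply] at this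
    simp [hε.ne'] at this
    exact ht this

/-- Geometric data degenerating from base changes of the perturbations of `V`. -/
theorem exists_geometric_limit (hσp : ∀ i, 0 < σ (Sum.inl i))
    (hσn : ∀ j, σ (Sum.inr j) < 0) (hσβ : ∑ x, σ x * (β x : ℤ) = 0) (hx : ∃ x, 0 < β x) :
    ∃ (h : ∀ x, Matrix (Fin (β x)) (Fin (β x)) ℝ) (U : Rep (ExtArrow A β) β), sumSq h = 1 ∧
      IsGeometric U σ ∧
      ∀ i j a, h (Sum.inr j) * perturb V 0 i j a = U i j a * h (Sum.inl i) := by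
  -- The intertwining relation replaces invertibility of `h`: it is closed and invariant under
  -- scaling `h`, so it survives normalization and the limit.
  let K : Set (ℝ × (∀ x, Matrix (Fin (β x)) (Fin (β x)) ℝ) × Rep (ExtArrow A β) β) :=
    {p | p.1 ∈ Set.Icc (0 : ℝ) 1 ∧ sumSq p.2.1 = 1 ∧ IsGeometric p.2.2 σ ∧
      ∀ i j a, p.2.1 (Sum.inr j) * perturb V p.1 i j a = p.2.2 i j a * p.2.1 (Sum.inl i)}
  have hcont : ∀ i j a, Continuous fun p : ℝ × (∀ x, Matrix (Fin (β x)) (Fin (β x)) ℝ) ×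
      Rep (ExtArrow A β) β => perturb V p.1 i j a := by
    rintro i j (a | ⟨s, t⟩)
    · exact continuous_const
    · refine continuous_matrix fun s' t' => ?_
      simp only [perturb, Sum.elim_inr, single_apply]
      split_ifs
      · exact continuous_fst
      · exact continuous_const
  have hclosed : IsClosed K := by
    have h1 : IsClosed {p : ℝ × (∀ x, Matrix (Fin (β x)) (Fin (β x)) ℝ) ×
        Rep (ExtArrow A β) β | p.1 ∈ Set.Icc (0 : ℝ) 1} := isClosed_Icc.preimage continuous_fst
    have h2 : IsClosed {p : ℝ × (∀ x, Matrix (Fin (β x)) (Fin (β x)) ℝ) ×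
        Rep (ExtArrow A β) β | sumSq p.2.1 = 1} :=
      isClosed_eq (continuous_sumSq.comp (continuous_fst.comp continuous_snd)) continuous_const
    have h3 : IsClosed {p : ℝ × (∀ x, Matrix (Fin (β x)) (Fin (β x)) ℝ) ×
        Rep (ExtArrow A β) β | IsGeometric p.2.2 σ} := by
      simp only [IsGeometric, Set.ofPred_and, Set.ofPred_forall]
      refine (isClosed_iInter fun i => isClosed_eq ?_ continuous_const).inter
        (isClosed_iInter fun j => isClosed_eq ?_ continuous_const)
      · fun_prop
      · fun_prop
    have h4 : IsClosed {p : ℝ × (∀ x, Matrix (Fin (β x)) (Fin (β x)) ℝ) ×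
        Rep (ExtArrow A β) β | ∀ i j a, p.2.1 (Sum.inr j) * perturb V p.1 i j a
          = p.2.2 i j a * p.2.1 (Sum.inl i)} := by
      simp only [Set.ofPred_forall]
      refine isClosed_iInter fun i => isClosed_iInter fun j => isClosed_iInter fun a =>
        isClosed_eq ?_ ?_
      · exact Continuous.matrix_mul (by fun_prop) (hcont i j a)
      · fun_prop
    exact h1.inter (h2.inter (h3.inter h4))
  have hcompact : IsCompact K :=
    (isCompact_Icc.prod ((isCompact_entries β β).prod
      (isCompact_rep_entries (ExtArrow A β) β))).of_isClosed_subset hclosed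
      fun p hp => ⟨hp.1, fun x s t => mem_Icc_of_sumSq_eq_one hp.2.1 x s t,
        fun i j a s t => hp.2.2.1.entry_mem_Icc hσn i j a s t⟩
  -- The set of attained `ε` is compact and contains `(0, 1]`, hence contains 0.
  have himage : IsClosed (Prod.fst '' K) := (hcompact.image continuous_fst).isClosed
  have hmem : ∀ ε : ℝ, 0 < ε → ε ≤ 1 → ε ∈ Prod.fst '' K := by
    intro ε hε hε1
    obtain ⟨S, hS⟩ := exists_isBalanced_perturb (V := V) hσp hσn hσβ hx hε
    obtain ⟨g, hg, -⟩ := isBalanced_iff.1 hS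
    obtain ⟨x, hx⟩ := hx
    have hgx : (g x).val ≠ 0 := by
      have : Nonempty (Fin (β x)) := ⟨⟨0, hx⟩⟩
      exact (g x).ne_zero
    obtain ⟨c, -, hc⟩ := exists_sumSq_smul_eq_one (L := fun x => (g x).val) hgx
    refine ⟨(ε, fun x => c • (g x).val, act g (perturb V ε)), ⟨⟨hε.le, hε1⟩, hc, hg, ?_⟩, rfl⟩
    intro i j a
    simp only [act, Matrix.mul_smul, Matrix.smul_mul, Matrix.mul_assoc]
    simp
  have hzero : (0 : ℝ) ∈ Prod.fst '' K := by
    refine himage.mem_of_tendsto (b := Filter.atTop) tendsto_one_div_add_atTop_nhds_zero_nat ?_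
    refine Filter.Eventually.of_forall fun n : ℕ => hmem _ (by positivity) ?_
    rw [div_le_one (by positivity)]
    linarith [(Nat.cast_nonneg n : (0 : ℝ) ≤ n)]
  obtain ⟨⟨ε, h, U⟩, ⟨-, h1, h2, h3⟩, rfl⟩ := hzero
  exact ⟨h, U, h1, h2, h3⟩

/-- A stable representation admits a base change to a geometric datum. -/
theorem exists_mem_geometrizers_of_stable (hσp : ∀ i, 0 < σ (Sum.inl i))
    (hσn : ∀ j, σ (Sum.inr j) < 0) (hV : IsStable σ (SubRep.univ V)) :
    ∃ g, g ∈ geometrizers V σ := by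
  obtain ⟨⟨x₀, hx₀⟩, hw, hst⟩ := hV
  have hσβ : ∑ x, σ x * (β x : ℤ) = 0 := by
    simpa only [weight, finrank_univ_space] using hw
  have hx : ∃ x, 0 < β x := by
    refine ⟨x₀, Nat.pos_of_ne_zero fun h0 => hx₀ ?_⟩
    rw [← Submodule.finrank_eq_zero (R := ℝ), finrank_univ_space, h0]
  obtain ⟨h, U, h1, hU, hh⟩ := exists_geometric_limit (V := V) hσp hσn hσβ hx
  -- The kernel of `h`, viewed in `V` by forgetting the new arrows. Rank-nullity and the nonpositive
  -- weight of the image make its weight nonnegative.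
  let K : SubRep V := ⟨((SubRep.zero U).comap h hh).space, fun i j a =>
    ((SubRep.zero U).comap h hh).map_mem i j (Sum.inl a)⟩
  have hKw : 0 ≤ weight σ K := by
    have e := weight_ker_add_weight_range (σ := σ) h hh
    rw [weight_univ hσβ] at e
    have := hU.weight_nonpos hσp hσn ((SubRep.univ _).map h hh)
    change 0 ≤ weight σ ((SubRep.zero U).comap h hh)
    linarith
  have hK : ∀ x, K.space x = ⊥ := by
    by_contra! hne
    have hKu : K = SubRep.univ V := by
      by_contra hKu
      exact absurd (hst K (fun x => le_top) hne hKu) (not_lt.2 hKw)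
    have h0 : ∀ x, h x = 0 := by
      intro x
      refine ext_of_mulVec_single fun s => ?_
      have : Pi.single s 1 ∈ K.space x := by rw [hKu]; exact Submodule.mem_top
      rw [zero_mulVec]
      exact this
    simp [sumSq, h0] at h1
  have hunit : ∀ x, IsUnit (h x) := by
    intro x
    refine mulVec_injective_iff_isUnit.1 ?_
    have : LinearMap.ker (h x).mulVecLin = ⊥ := hK x
    exact LinearMap.ker_eq_bot.1 this
  let g : GLβ β := fun x => (hunit x).unit
  have hg : ∀ x, (g x).val = h x := fun x => rfl
  have hUg : ∀ i j a, U i j a = h (Sum.inr j) * perturb V 0 i j a * ((g (Sum.inl i))⁻¹).val := by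
    intro i j a
    rw [hh, ← hg, Matrix.mul_assoc]
    simp
  have hUl : ∀ i j (a : A i j), U i j (Sum.inl a) = act g V i j a := fun i j a => hUg _ _ _
  -- At `ε = 0` the new arrows vanish, so they contribute nothing to the geometric identities of
  -- `U`.
  have hUr : ∀ i j p, U i j (Sum.inr p) = 0 := by
    intro i j p
    rw [hUg]
    simp [perturb]
  refine ⟨g, ?_, ?_⟩
  · intro i
    simpa [Fintype.sum_sum_type, hUl, hUr] using hU.1 i
  · intro j
    simpa [Fintype.sum_sum_type, hUl, hUr] using hU.2 j

end Stable

/-! ### From stable summands to polystable representations. -/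

section DirectSum

variable {ι : Type*} [Fintype ι]

/-- A form assembled from positive definite forms on the summands of a direct sum, where `B l` and
`C l` are the inclusion and projection matrices. -/
theorem sum_frame_mul_eq_one {n : ℕ} {d : ι → ℕ} {B : ∀ l, Matrix (Fin n) (Fin (d l)) ℝ}
    {C : ∀ l, Matrix (Fin (d l)) (Fin n) ℝ} (hCB : ∀ l, C l * B l = 1)
    (hCB₀ : ∀ l m, l ≠ m → C l * B m = 0) (hBC : ∑ l, B l * C l = 1)
    {Q : ∀ l, Matrix (Fin (d l)) (Fin (d l)) ℝ} (hQ : ∀ l, (Q l).PosDef) :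
    (∑ l, B l * Q l * (B l)ᵀ) * (∑ l, (C l)ᵀ * (Q l)⁻¹ * C l) = 1 := by
  classical
  rw [Matrix.sum_mul, ← hBC]
  refine Finset.sum_congr rfl fun l _ => ?_
  rw [Matrix.mul_sum, Finset.sum_eq_single l]
  · calc _ = B l * (Q l * ((B l)ᵀ * (C l)ᵀ) * (Q l)⁻¹) * C l := by simp only [Matrix.mul_assoc]
      _ = _ := by
        rw [← transpose_mul, hCB, transpose_one, Matrix.mul_one,
          mul_nonsing_inv _ ((isUnit_iff_isUnit_det _).1 (hQ l).isUnit), Matrix.mul_one]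
  · intro m _ hm
    calc _ = B l * (Q l * ((B l)ᵀ * (C m)ᵀ) * (Q m)⁻¹) * C m := by simp only [Matrix.mul_assoc]
      _ = _ := by rw [← transpose_mul, hCB₀ m l hm]; simp
  · simp

theorem sum_frame_posDef {n : ℕ} {d : ι → ℕ} {B : ∀ l, Matrix (Fin n) (Fin (d l)) ℝ}
    {C : ∀ l, Matrix (Fin (d l)) (Fin n) ℝ} (hCB : ∀ l, C l * B l = 1)
    (hCB₀ : ∀ l m, l ≠ m → C l * B m = 0) (hBC : ∑ l, B l * C l = 1)
    {Q : ∀ l, Matrix (Fin (d l)) (Fin (d l)) ℝ} (hQ : ∀ l, (Q l).PosDef) :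
    (∑ l, B l * Q l * (B l)ᵀ).PosDef := by
  refine PosSemidef.posDef_of_det_ne_zero
    (posSemidef_sum _ fun l _ => (hQ l).posSemidef.mul_mul_transpose_same _) fun h0 => ?_
  have := congrArg det (sum_frame_mul_eq_one hCB hCB₀ hBC hQ)
  rw [det_mul, h0, zero_mul, det_one] at this
  exact zero_ne_one this

theorem sum_frame_inv {n : ℕ} {d : ι → ℕ} {B : ∀ l, Matrix (Fin n) (Fin (d l)) ℝ}
    {C : ∀ l, Matrix (Fin (d l)) (Fin n) ℝ} (hCB : ∀ l, C l * B l = 1)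
    (hCB₀ : ∀ l m, l ≠ m → C l * B m = 0) (hBC : ∑ l, B l * C l = 1)
    {Q : ∀ l, Matrix (Fin (d l)) (Fin (d l)) ℝ} (hQ : ∀ l, (Q l).PosDef) :
    (∑ l, B l * Q l * (B l)ᵀ)⁻¹ = ∑ l, (C l)ᵀ * (Q l)⁻¹ * C l :=
  inv_eq_right_inv (sum_frame_mul_eq_one hCB hCB₀ hBC hQ)

variable {I J : Type*} {A : I → J → Type*} {β : I ⊕ J → ℕ}
variable [Fintype I] [Fintype J] [∀ i j, Fintype (A i j)] {σ : I ⊕ J → ℤ} {V : Rep A β}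

/-- A direct sum of representations with balanced tuples has a balanced tuple. -/
theorem exists_isBalanced_of_directSum {γ : ι → I ⊕ J → ℕ} {U : ∀ l, Rep A (γ l)}
    {B : ∀ l x, Matrix (Fin (β x)) (Fin (γ l x)) ℝ} {C : ∀ l x, Matrix (Fin (γ l x)) (Fin (β x)) ℝ}
    (hCB : ∀ x l, C l x * B l x = 1) (hCB₀ : ∀ x l m, l ≠ m → C l x * B m x = 0)
    (hBC : ∀ x, ∑ l, B l x * C l x = 1)
    (hB : ∀ l i j (a : A i j), V i j a * B l (Sum.inl i) = B l (Sum.inr j) * U l i j a)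
    (hU : ∀ l, ∃ S, IsBalanced (U l) σ S) : ∃ S, IsBalanced V σ S := by
  classical
  choose S hS using hU
  -- Since the inclusions `B` are morphisms, so are the projections `C`; push-forward uses the
  -- former, pull-back the latter.
  have hC : ∀ l i j (a : A i j), C l (Sum.inr j) * V i j a = U l i j a * C l (Sum.inl i) := by
    intro l i j a
    calc _ = C l (Sum.inr j) * V i j a * ∑ m, B m (Sum.inl i) * C m (Sum.inl i) := by
          rw [hBC, Matrix.mul_one]
      _ = ∑ m, C l (Sum.inr j) * B m (Sum.inr j) * U m i j a * C m (Sum.inl i) := by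
          rw [Matrix.mul_sum]
          refine Finset.sum_congr rfl fun m _ => ?_
          rw [Matrix.mul_assoc, ← Matrix.mul_assoc (V i j a), hB]
          simp only [Matrix.mul_assoc]
      _ = _ := by
          rw [Finset.sum_eq_single l]
          · rw [hCB, Matrix.one_mul]
          · intro m _ hm
            rw [hCB₀ _ l m hm.symm]; simp
          · simp
  have hpush : ∀ j, pushForm V σ
      (fun i => ∑ l, B l (Sum.inl i) * S l i * (B l (Sum.inl i))ᵀ) j
      = ∑ l, B l (Sum.inr j) * pushForm (U l) σ (S l) j * (B l (Sum.inr j))ᵀ := by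
    intro j
    simp only [pushForm, Matrix.mul_sum, Matrix.sum_mul, Matrix.mul_smul, Matrix.smul_mul]
    rw [Finset.sum_comm (s := (Finset.univ : Finset ι))]
    refine Finset.sum_congr rfl fun i _ => ?_
    rw [Finset.sum_comm, Finset.smul_sum]
    refine Finset.sum_congr rfl fun l _ => ?_
    congr 1
    refine Finset.sum_congr rfl fun a _ => ?_
    have hBt := congrArg transpose (hB l i j a)
    simp only [transpose_mul] at hBt
    calc _ = (V i j a * B l (Sum.inl i)) * S l i * ((B l (Sum.inl i))ᵀ * (V i j a)ᵀ) := by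
          simp only [Matrix.mul_assoc]
      _ = _ := by rw [hB, hBt]; simp only [Matrix.mul_assoc]
  have hinv : ∀ j, (pushForm V σ
      (fun i => ∑ l, B l (Sum.inl i) * S l i * (B l (Sum.inl i))ᵀ) j)⁻¹
      = ∑ l, (C l (Sum.inr j))ᵀ * (pushForm (U l) σ (S l) j)⁻¹ * C l (Sum.inr j) := by
    intro j
    rw [hpush]
    exact sum_frame_inv (hCB _) (hCB₀ _) (hBC _) fun l => (hS l).posDef_pushForm j
  refine ⟨fun i => ∑ l, B l (Sum.inl i) * S l i * (B l (Sum.inl i))ᵀ, fun i => ?_, fun j => ?_,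
    fun i => ?_⟩
  · exact sum_frame_posDef (hCB _) (hCB₀ _) (hBC _) fun l => (hS l).posDef i
  · rw [hpush]
    exact sum_frame_posDef (hCB _) (hCB₀ _) (hBC _) fun l => (hS l).posDef_pushForm j
  · rw [sum_frame_inv (hCB _) (hCB₀ _) (hBC _) fun l => (hS l).posDef i]
    simp only [hinv, ← (hS _).pullForm_inv i]
    simp only [pullForm, Matrix.mul_sum, Matrix.sum_mul, Matrix.mul_smul, Matrix.smul_mul]
    rw [Finset.sum_comm (s := (Finset.univ : Finset ι))]
    refine Finset.sum_congr rfl fun j _ => ?_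
    rw [Finset.sum_comm, Finset.smul_sum]
    refine Finset.sum_congr rfl fun l _ => ?_
    congr 1
    refine Finset.sum_congr rfl fun a _ => ?_
    have hCt := congrArg transpose (hC l i j a)
    simp only [transpose_mul] at hCt
    calc _ = ((V i j a)ᵀ * (C l (Sum.inr j))ᵀ) * (pushForm (U l) σ (S l) j)⁻¹ *
          (C l (Sum.inr j) * V i j a) := by simp only [Matrix.mul_assoc]
      _ = _ := by rw [hC, hCt]; simp only [Matrix.mul_assoc]

/-- Inclusion and projection matrices of an internal direct sum. -/
theorem exists_frames_of_isInternal {n m : ℕ} {F : Fin m → Submodule ℝ (Fin n → ℝ)}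
    (hF : DirectSum.IsInternal F) :
    ∃ (B : ∀ l, Matrix (Fin n) (Fin (Module.finrank ℝ (F l))) ℝ)
      (C : ∀ l, Matrix (Fin (Module.finrank ℝ (F l))) (Fin n) ℝ), (∀ l, C l * B l = 1) ∧
      (∀ l k, l ≠ k → C l * B k = 0) ∧ ∑ l, B l * C l = 1 ∧
      ∀ l, LinearMap.range (B l).mulVecLin = F l := by
  let f := fun l => Module.finBasis ℝ (F l)
  let b := hF.collectedBasis f
  have hb : ∀ p, b p = (f p.1 p.2 : Fin n → ℝ) := fun p => by
    rw [hF.collectedBasis_coe]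
  let B : ∀ l, Matrix (Fin n) (Fin (Module.finrank ℝ (F l))) ℝ := fun l =>
    Matrix.of fun t s => (f l s : Fin n → ℝ) t
  let C : ∀ l, Matrix (Fin (Module.finrank ℝ (F l))) (Fin n) ℝ := fun l =>
    Matrix.of fun s t => b.repr (Pi.single t 1) ⟨l, s⟩
  have hrepr : ∀ (v : Fin n → ℝ) p, b.repr v p = ∑ t, b.repr (Pi.single t 1) p * v t := by
    intro v p
    have hv : v = ∑ t, v t • (Pi.single t 1 : Fin n → ℝ) := by
      ext s
      simp [Pi.single_apply]
    conv_lhs => rw [hv]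
    simp [map_sum, map_smul, mul_comm]
  have hCB : ∀ l k s s', (C l * B k) s s' = b.repr (b ⟨k, s'⟩) ⟨l, s⟩ := by
    intro l k s s'
    rw [Matrix.mul_apply, hrepr, hb]
    rfl
  refine ⟨B, C, fun l => ?_, fun l k hlk => ?_, ?_, fun l => ?_⟩
  · ext s s'
    rw [hCB, Module.Basis.repr_self, Finsupp.single_apply, one_apply]
    simp [eq_comm]
  · ext s s'
    rw [hCB, Module.Basis.repr_self, Finsupp.single_apply, if_neg]
    · rfl
    · exact fun h => hlk (congrArg Sigma.fst h).symm
  · ext t t'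
    have h := congrFun (b.sum_repr (Pi.single t' 1)) t
    rw [Fintype.sum_sigma, Finset.sum_apply] at h
    simp only [Finset.sum_apply, Pi.smul_apply, smul_eq_mul, hb] at h
    rw [Matrix.sum_apply, one_apply]
    simp only [Matrix.mul_apply, B, C, Matrix.of_apply]
    rw [Pi.single_apply] at h
    rw [← h]
    exact Finset.sum_congr rfl fun l _ => Finset.sum_congr rfl fun s _ => mul_comm _ _
  · have hBv : ∀ v, B l *ᵥ v = ((∑ s, v s • f l s : F l) : Fin n → ℝ) := by
      intro v
      ext t
      simp [B, mulVec, dotProduct, mul_comm]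
    ext u
    constructor
    · rintro ⟨v, rfl⟩
      rw [mulVecLin_apply, hBv]
      exact Submodule.coe_mem _
    · intro hu
      refine ⟨(f l).equivFun ⟨u, hu⟩, ?_⟩
      rw [mulVecLin_apply, hBv, Module.Basis.sum_equivFun]

/-- Each stable summand becomes a representation `U l` in coordinates. Its subrepresentations embed,
with the same weight, as subrepresentations of `V` inside the summand, so stability transfers and
the stable case applies. -/
theorem IsPolystable.exists_isBalanced [DecidableEq I] [DecidableEq J]
    (hσp : ∀ i, 0 < σ (Sum.inl i)) (hσn : ∀ j, σ (Sum.inr j) < 0) (hV : IsPolystable V σ) :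
    ∃ S, IsBalanced V σ S := by
  obtain ⟨n, W, hst, hint⟩ := hV
  choose B C hCB hCB₀ hBC hBW using fun x => exists_frames_of_isInternal (hint x)
  let U : ∀ l, Rep A fun x => Module.finrank ℝ ((W l).space x) := fun l i j a =>
    C (Sum.inr j) l * V i j a * B (Sum.inl i) l
  have hB : ∀ l i j (a : A i j), V i j a * B (Sum.inl i) l = B (Sum.inr j) l * U l i j a := by
    intro l i j a
    refine ext_of_mulVec_single fun s => ?_
    have hmem : (V i j a * B (Sum.inl i) l) *ᵥ Pi.single s 1 ∈ (W l).space (Sum.inr j) := by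
      rw [← mulVec_mulVec]
      exact (W l).map_mem i j a _ ((hBW _ l).le ⟨_, rfl⟩)
    obtain ⟨v, hv⟩ := (hBW _ l).ge hmem
    rw [mulVecLin_apply] at hv
    have e : B (Sum.inr j) l * U l i j a
        = B (Sum.inr j) l * C (Sum.inr j) l * (V i j a * B (Sum.inl i) l) := by
      simp only [U, Matrix.mul_assoc]
    rw [e, ← mulVec_mulVec (M := B (Sum.inr j) l * C (Sum.inr j) l), ← hv, mulVec_mulVec, Matrix.mul_assoc, hCB, Matrix.mul_one]
  refine exists_isBalanced_of_directSum (B := fun l x => B x l) (C := fun l x => C x l) (U := U)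
    hCB hCB₀ hBC hB fun l => ?_
  have hinj : ∀ x, Function.Injective (B x l).mulVecLin := by
    intro x v w hvw
    have := congrArg (fun u => C x l *ᵥ u) hvw
    simpa only [mulVecLin_apply, mulVec_mulVec, hCB, one_mulVec] using this
  have hle : ∀ (W' : SubRep (U l)) x,
      (W'.map (U := V) (fun x => B x l) (fun i j a => (hB l i j a).symm)).space x
        ≤ (W l).space x := by
    rintro W' x _ ⟨v, -, rfl⟩
    exact (hBW x l).le ⟨v, rfl⟩
  have hstable : IsStable σ (SubRep.univ (U l)) := by
    obtain ⟨⟨x₀, hx₀⟩, hw, hlt⟩ := hst l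
    refine ⟨⟨x₀, fun h0 => hx₀ ?_⟩, weight_univ hw, fun W' _ ⟨x, hx⟩ hne => ?_⟩
    · rw [← Submodule.finrank_eq_zero (R := ℝ)] at h0 ⊢
      exact (finrank_univ_space (U l) x₀).symm.trans h0
    · rw [← weight_map (U := V) (fun x => B x l) (fun i j a => (hB l i j a).symm) hinj]
      refine hlt _ (hle W') ⟨x, fun h0 => hx ?_⟩ fun heq => hne ?_
      · exact (Submodule.map_injective_of_injective (hinj x)) (h0.trans (Submodule.map_bot _).symm)
      · ext1
        ext1 y
        refine Submodule.eq_top_of_finrank_eq ?_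
        rw [Module.finrank_fin_fun,
          (Submodule.equivMapOfInjective _ (hinj y) (W'.space y)).finrank_eq]
        exact congrArg (fun W : SubRep V => Module.finrank ℝ (W.space y)) heq
  obtain ⟨g, hg⟩ := exists_mem_geometrizers_of_stable hσp hσn hstable
  exact ⟨_, isBalanced_iff.2 ⟨g, hg, rfl⟩⟩

end DirectSum

end BipartiteQuiver

/-! ### The equivalence and the description of extremizers. -/

theorem theorem3p3 {I J : Type*} [Fintype I] [Fintype J] [DecidableEq I] [DecidableEq J]
    {A : I → J → Type*} [∀ i j, Fintype (A i j)]
    (β : I ⊕ J → ℕ) (hβ : ∀ x, 0 < β x)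
    (σ : I ⊕ J → ℤ) (hσ_pos : ∀ i, 0 < σ (Sum.inl i)) (hσ_neg : ∀ j, σ (Sum.inr j) < 0)
    (hσβ : ∑ x, σ x * (β x : ℤ) = 0)
    (V : BipartiteQuiver.Rep A β) (hV : V ≠ 0) :
    (BipartiteQuiver.IsPolystable V σ ↔
      BipartiteQuiver.SpansSinks V ∧ BipartiteQuiver.IsGaussianExtremizable V σ) ∧
    (BipartiteQuiver.IsPolystable V σ →
      {S | BipartiteQuiver.IsGaussianExtremizer V σ S} =
        {S | ∃ g ∈ BipartiteQuiver.geometrizers V σ, S = fun i =>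
          ((g (Sum.inl i))⁻¹).val * ((g (Sum.inl i))⁻¹).val.transpose}) := by
  have hc := BipartiteQuiver.card_rowIdx_eq hσ_pos hσ_neg hσβ
  have hspan : BipartiteQuiver.IsPolystable V σ → BipartiteQuiver.SpansSinks V := fun h => by
    obtain ⟨S, hS⟩ := h.exists_isBalanced hσ_pos hσ_neg
    exact BipartiteQuiver.spansSinks_of_posDef_pushForm hS.posDef_pushForm
  refine ⟨⟨fun h => ⟨hspan h, ?_⟩, fun ⟨hs, S, hS⟩ => ?_⟩, fun h => ?_⟩
  · obtain ⟨S, hS⟩ := h.exists_isBalanced hσ_pos hσ_neg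
    exact ⟨S, hS.isGaussianExtremizer hc⟩
  · obtain ⟨g, hg, -⟩ := BipartiteQuiver.isBalanced_iff.1 (hS.isBalanced hσ_pos hc hs)
    exact BipartiteQuiver.isPolystable_of_mem_geometrizers hσ_pos hσ_neg hσβ hg
  · ext S
    exact ⟨fun hS => BipartiteQuiver.isBalanced_iff.1 (hS.isBalanced hσ_pos hc (hspan h)),
      fun hS => (BipartiteQuiver.isBalanced_iff.2 hS).isGaussianExtremizer hc⟩
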